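/- Let $E\subset\mathbb{R}$ be a union of finitely many pairwise disjoint compact intervals $[a_j,b_j]$, $a_j\le b_j$, and let $\mu$ be a finite Borel measure on $\mathbb{R}$ with compact support whose essential support $\sigma_{\mathrm{ess}}(\mu)$, i.e. the set of non-isolated points of $\operatorname{supp}\mu$, equals $E$. Write $|\cdot|$ for Lebesgue measure and suppose that for every $\eta>0$, $$\lim_{m\to\infty}\Bigl|\bigl\{x\in E : \mu\bigl([x-\tfrac1m,x+\tfrac1m]\bigr)\le e^{-m\eta}\bigr\}\Bigr|=0 ,$$ where $m$ runs through the positive integers. Then $\mu$ is regular, that is, the monic orthogonal polynomials $P_n(x)=x^n+\text{lower order}$ of $\mu$ satisfy $$\lim_{n\to\infty}\|P_n\|_{L^2(\mu)}^{1/n}=C(\operatorname{supp}\mu).$$ Here the logarithmic capacity of a compact set $K\subset\mathbb{R}$ is $C(K)=\exp\bigl(-\inf_\rho\iint\log|x-y|^{-1}\,d\rho(x)\,d\rho(y)\bigr)$, the infimum being over all Borel probability measures $\rho$ on $K$ and the energy taking values in $(-\infty,\infty]$; $C(K)=0$ if every such energy is $+\infty$. -/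

import Mathlib

open MeasureTheory Filter Topology

/-- The logarithmic kernel `log |x - y|⁻¹`, with the value `+∞` on the diagonal. -/
noncomputable def logKernel (x y : ℝ) : EReal := -ENNReal.log (edist x y)

/-- The Coulomb (logarithmic) energy `∬ log |x - y|⁻¹ dρ(x) dρ(y)`, as the integral of the
positive part minus the integral of the negative part. For a finite measure of bounded support
the second integral is finite, so that the energy is a well defined element of `(-∞, ∞]`. -/
noncomputable def logEnergy (ρ : Measure ℝ) : EReal :=
  ((∫⁻ x, ∫⁻ y, (logKernel x y).toENNReal ∂ρ ∂ρ : ENNReal) : EReal)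
    - ((∫⁻ x, ∫⁻ y, (-logKernel x y).toENNReal ∂ρ ∂ρ : ENNReal) : EReal)

/-- The logarithmic capacity of a compact set `E ⊆ ℝ`: `exp (- inf ℰ(ρ))`, the infimum over all
probability measures `ρ` carried by `E`, and `0` if all of them have infinite energy. -/
noncomputable def logCapacity (E : Set ℝ) : ℝ :=
  (EReal.exp (-(⨅ (ρ : Measure ℝ) (_ : IsProbabilityMeasure ρ) (_ : ρ Eᶜ = 0),
    logEnergy ρ))).toReal

/-- The essential support (essential spectrum) of a measure on `ℝ`: the non-isolated points of
its topological support. -/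
def essSupport (μ : Measure ℝ) : Set ℝ :=
  {x | x ∈ μ.support ∧ AccPt x (𝓟 μ.support)}

/-- The norm of a polynomial in `L²(μ)`. -/
noncomputable def polyL2Norm (μ : Measure ℝ) (P : Polynomial ℝ) : ℝ :=
  Real.sqrt (∫ x, (P.eval x) ^ 2 ∂μ)

/-- `P n = xⁿ + lower order` for all `n`, and the `P n` are mutually orthogonal in `L²(μ)`. -/
structure IsMonicOrthogonalSeq (μ : Measure ℝ) (P : ℕ → Polynomial ℝ) : Prop where
  monic : ∀ n, (P n).Monic
  natDegree_eq : ∀ n, (P n).natDegree = n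
  orthogonal : ∀ n m, n ≠ m → ∫ x, (P n).eval x * (P m).eval x ∂μ = 0

/-- A finite measure on `ℝ` is regular if it has compact support and the monic orthogonal
polynomials satisfy `‖P n‖^(1/n) → C(supp μ)`. (Monic orthogonal polynomials always exist, and
their norms are uniquely determined by `μ`.) -/
def IsRegularMeasure (μ : Measure ℝ) : Prop :=
  IsCompact μ.support ∧ ∃ P : ℕ → Polynomial ℝ, IsMonicOrthogonalSeq μ P ∧
    Tendsto (fun n : ℕ => polyL2Norm μ (P n) ^ (1 / (n : ℝ))) atTop
      (𝓝 (logCapacity μ.support))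

/-! Upper bound, valid for every compactly supported `μ`. If every monic polynomial of positive
degree exceeded `c ^ deg` somewhere on `K`, greedily chosen points (Leja points) would have
empirical measures with a weak limit of energy at most `-log c`, so the capacity would be at least
`c`. Hence for `c` above the capacity some monic `T` is at most `c ^ deg T` on `K`
(`exists_monic_le_of_logCapacity_lt`), and the extremality of `P n` is tested against powers of `T`
times a low power of `X`.

Lower bound. Suppose `‖P n‖ < c ^ n` with `c < d < C(supp μ)`, and put `S = {|P n| ≤ d ^ n}`. Take
`m = k n` with `k` fixed and `η` such that `exp (-m η) = (c / d) ^ (2 n)`. By Chebyshev's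
inequality, an interval of radius `1/m` with mass above `exp (-m η)` meets `S`, so the hypothesis
makes the `1/m`-neighbourhood of `S` cover `E` up to small length. The neighbourhood adds at most `4
n / m = 4 / k` to the length of `S`, because `|P n| = d ^ n` has at most `2 n` solutions. Thus `E \
S` has small length.

A measure on `supp μ` of energy below `-log d` charges no countable set, so it lives on `E`. By
`HasLogEnergy.exists_pos_forall_subset`, any set missing little of the length of `E` still carries a
measure of energy below `-log d`: contract the intervals slightly, choose by averaging a translate
that puts little mass off `S`, and condition on `S`. This contradicts `HasLogEnergy.neg_mul_le_log`:
a monic polynomial of degree `n` bounded by `d ^ n` on a set forces every energy there to be at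
least `-log d`. -/

/-! ### Logarithmic energy as a real integral, and capacity -/

/-- The real-valued logarithmic kernel on pairs of points. -/
noncomputable def logDist (p : ℝ × ℝ) : ℝ := -Real.log (dist p.1 p.2)

@[fun_prop]
theorem measurable_logDist : Measurable logDist := by
  unfold logDist; fun_prop

/-- `ρ` does not charge the diagonal, and its logarithmic energy is the real number `I`. -/
structure HasLogEnergy (ρ : Measure ℝ) (I : ℝ) : Prop where
  ae_ne : ∀ᵐ p ∂ρ.prod ρ, p.1 ≠ p.2
  integrable : Integrable logDist (ρ.prod ρ)
  integral_eq : ∫ p, logDist p ∂ρ.prod ρ = I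

theorem logKernel_of_ne {x y : ℝ} (h : x ≠ y) : logKernel x y = (logDist (x, y) : ℝ) := by
  rw [logKernel, logDist, edist_dist, ENNReal.log_ofReal_of_pos (dist_pos.2 h)]
  simp

theorem logKernel_self (x : ℝ) : logKernel x x = ⊤ := by
  simp [logKernel]

theorem measurable_logKernel : Measurable fun p : ℝ × ℝ => logKernel p.1 p.2 := by
  unfold logKernel
  have : Measurable fun p : ℝ × ℝ => ENNReal.log (edist p.1 p.2) :=
    ENNReal.measurable_log.comp measurable_edist
  exact this.neg

theorem EReal_toENNReal_coe (r : ℝ) : (r : EReal).toENNReal = ENNReal.ofReal r := by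
  simp

theorem logEnergy_eq_prod (ρ : Measure ℝ) [IsFiniteMeasure ρ] :
    logEnergy ρ = ((∫⁻ p, (logKernel p.1 p.2).toENNReal ∂ρ.prod ρ : ENNReal) : EReal)
      - ((∫⁻ p, (-logKernel p.1 p.2).toENNReal ∂ρ.prod ρ : ENNReal) : EReal) := by
  have h : Measurable fun p : ℝ × ℝ => (-logKernel p.1 p.2).toENNReal :=
    measurable_logKernel.neg.ereal_toENNReal
  rw [logEnergy, lintegral_prod _ measurable_logKernel.ereal_toENNReal.aemeasurable,
    lintegral_prod _ h.aemeasurable]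

theorem HasLogEnergy.logEnergy_eq {ρ : Measure ℝ} [IsFiniteMeasure ρ] {I : ℝ}
    (h : HasLogEnergy ρ I) : logEnergy ρ = I := by
  have h1 : ∫⁻ p, (logKernel p.1 p.2).toENNReal ∂ρ.prod ρ
      = ∫⁻ p, ENNReal.ofReal (logDist p) ∂ρ.prod ρ := by
    refine lintegral_congr_ae ?_
    filter_upwards [h.ae_ne] with p hp
    rw [logKernel_of_ne hp, EReal_toENNReal_coe]
  have h2 : ∫⁻ p, (-logKernel p.1 p.2).toENNReal ∂ρ.prod ρ
      = ∫⁻ p, ENNReal.ofReal (-logDist p) ∂ρ.prod ρ := by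
    refine lintegral_congr_ae ?_
    filter_upwards [h.ae_ne] with p hp
    rw [logKernel_of_ne hp, ← EReal.coe_neg, EReal_toENNReal_coe]
  rw [logEnergy_eq_prod, h1, h2, ← h.integral_eq,
    integral_eq_lintegral_pos_part_sub_lintegral_neg_part h.integrable, EReal.coe_sub,
    EReal.coe_ennreal_toReal, EReal.coe_ennreal_toReal]
  · exact (h.integrable.neg.lintegral_lt_top).ne
  · exact (h.integrable.lintegral_lt_top).ne

theorem ae_prod_mem {ρ : Measure ℝ} [IsFiniteMeasure ρ] {K : Set ℝ} (hK : ρ Kᶜ = 0) :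
    ∀ᵐ p ∂ρ.prod ρ, p.1 ∈ K ∧ p.2 ∈ K := by
  have h : ∀ᵐ x ∂ρ, x ∈ K := hK
  exact (Measure.quasiMeasurePreserving_fst.ae h).and (Measure.quasiMeasurePreserving_snd.ae h)

theorem exists_dist_le_of_isBounded {K : Set ℝ} (hK : Bornology.IsBounded K) :
    ∃ R : ℝ, 1 ≤ R ∧ ∀ x ∈ K, ∀ y ∈ K, dist x y ≤ R := by
  obtain ⟨R, hR⟩ := Metric.isBounded_iff.1 hK
  exact ⟨max R 1, le_max_right _ _, fun x hx y hy => (hR hx hy).trans (le_max_left _ _)⟩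

theorem neg_log_le_logDist {R : ℝ} (hR : 1 ≤ R) {p : ℝ × ℝ} (h : dist p.1 p.2 ≤ R) :
    -Real.log R ≤ logDist p := by
  rw [logDist, neg_le_neg_iff]
  rcases eq_or_ne p.1 p.2 with h' | h'
  · simp [h', Real.log_nonneg hR]
  · exact Real.log_le_log (dist_pos.2 h') h

/-- On a bounded set the negative part of the kernel is at most `log R`, so finite energy makes the
positive part integrable; the kernel is `⊤` on the diagonal, which is therefore null. -/
theorem exists_hasLogEnergy_of_lt_top {ρ : Measure ℝ} [IsFiniteMeasure ρ] {K : Set ℝ}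
    (hK : Bornology.IsBounded K) (hρ : ρ Kᶜ = 0) (h : logEnergy ρ < ⊤) :
    ∃ I : ℝ, HasLogEnergy ρ I := by
  obtain ⟨R, hR1, hR⟩ := exists_dist_le_of_isBounded hK
  have hlow : ∀ᵐ p ∂ρ.prod ρ, (-logKernel p.1 p.2).toENNReal ≤ ENNReal.ofReal (Real.log R) := by
    filter_upwards [ae_prod_mem hρ] with p hp
    rcases eq_or_ne p.1 p.2 with h' | h'
    · rw [h', logKernel_self]; simp
    · rw [logKernel_of_ne h', ← EReal.coe_neg, EReal_toENNReal_coe]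
      apply ENNReal.ofReal_le_ofReal
      linarith [neg_log_le_logDist hR1 (p := p) (hR _ hp.1 _ hp.2)]
  have hneg : ∫⁻ p, (-logKernel p.1 p.2).toENNReal ∂ρ.prod ρ ≠ ⊤ := by
    refine ne_top_of_le_ne_top ?_ (lintegral_mono_ae hlow)
    rw [lintegral_const]
    exact ENNReal.mul_ne_top (by simp) (measure_ne_top _ _)
  have hpos : ∫⁻ p, (logKernel p.1 p.2).toENNReal ∂ρ.prod ρ ≠ ⊤ := by
    intro htop
    rw [logEnergy_eq_prod, htop] at h
    refine h.ne ?_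
    rw [EReal.coe_ennreal_top, EReal.top_sub]
    rwa [Ne, EReal.coe_ennreal_eq_top_iff]
  have hne : ∀ᵐ p ∂ρ.prod ρ, p.1 ≠ p.2 := by
    filter_upwards [ae_lt_top (measurable_logKernel.ereal_toENNReal) hpos] with p hp h'
    rw [h', logKernel_self] at hp
    simp at hp
  refine ⟨_, hne, ⟨measurable_logDist.aestronglyMeasurable, ?_⟩, rfl⟩
  rw [HasFiniteIntegral]
  calc ∫⁻ p, ‖logDist p‖ₑ ∂ρ.prod ρ
      ≤ ∫⁻ p, (logKernel p.1 p.2).toENNReal + (-logKernel p.1 p.2).toENNReal ∂ρ.prod ρ := by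
        refine lintegral_mono_ae ?_
        filter_upwards [hne] with p hp
        rw [logKernel_of_ne hp, ← EReal.coe_neg, EReal_toENNReal_coe, EReal_toENNReal_coe,
          Real.enorm_eq_ofReal_abs]
        rcases abs_cases (logDist p) with ⟨h1, _⟩ | ⟨h1, _⟩
        · rw [h1]; exact le_self_add
        · rw [h1]; exact le_add_self
    _ = _ := lintegral_add_left (measurable_logKernel.ereal_toENNReal) _
    _ < ⊤ := ENNReal.add_lt_top.2 ⟨hpos.lt_top, hneg.lt_top⟩

theorem neg_log_le_of_hasLogEnergy {ρ : Measure ℝ} [IsProbabilityMeasure ρ] {K : Set ℝ} {R I : ℝ}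
    (hR1 : 1 ≤ R) (hR : ∀ x ∈ K, ∀ y ∈ K, dist x y ≤ R) (hρ : ρ Kᶜ = 0) (h : HasLogEnergy ρ I) :
    -Real.log R ≤ I := by
  rw [← h.integral_eq]
  have : ∫ _p : ℝ × ℝ, -Real.log R ∂ρ.prod ρ = -Real.log R := by simp
  rw [← this]
  refine integral_mono_ae (integrable_const _) h.integrable ?_
  filter_upwards [ae_prod_mem hρ] with p hp
  exact neg_log_le_logDist hR1 (hR _ hp.1 _ hp.2)

theorem exists_hasLogEnergy_of_lt_logCapacity {K : Set ℝ} (hK : Bornology.IsBounded K) {c : ℝ}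
    (hc : 0 < c) (h : c < logCapacity K) :
    ∃ (ρ : Measure ℝ) (I : ℝ), IsProbabilityMeasure ρ ∧ ρ Kᶜ = 0 ∧ HasLogEnergy ρ I ∧
      I < -Real.log c := by
  rw [logCapacity] at h
  have h1 := (ENNReal.ofReal_lt_iff_lt_toReal hc.le (by
    intro htop; rw [htop] at h; simp at h; linarith)).2 h
  have h2 : ENNReal.ofReal c = EReal.exp (Real.log c : ℝ) := by
    rw [EReal.exp_coe, Real.exp_log hc]
  rw [h2, EReal.exp_lt_exp_iff, EReal.lt_neg_comm, ← EReal.coe_neg] at h1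
  simp only [iInf_lt_iff] at h1
  obtain ⟨ρ, hρ1, hρ, hI⟩ := h1
  obtain ⟨I, hI'⟩ := exists_hasLogEnergy_of_lt_top hK hρ (hI.trans (EReal.coe_lt_top _))
  refine ⟨ρ, I, hρ1, hρ, hI', ?_⟩
  rw [hI'.logEnergy_eq] at hI
  exact_mod_cast hI

/-- Boundedness of `K` is needed because `toReal` sends `⊤` to `0`: the uniform bound `-log R` keeps
the infimum of the energies away from `⊥`. -/
theorem HasLogEnergy.exp_neg_le_logCapacity {K : Set ℝ} (hK : Bornology.IsBounded K)
    {ρ : Measure ℝ} [IsProbabilityMeasure ρ] {I : ℝ} (hρ : ρ Kᶜ = 0) (h : HasLogEnergy ρ I) :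
    Real.exp (-I) ≤ logCapacity K := by
  obtain ⟨R, hR1, hR⟩ := exists_dist_le_of_isBounded hK
  set V : EReal := ⨅ (ρ : Measure ℝ) (_ : IsProbabilityMeasure ρ) (_ : ρ Kᶜ = 0), logEnergy ρ
    with hV
  have h1 : V ≤ I := by
    rw [← h.logEnergy_eq]
    exact iInf_le_of_le ρ (iInf_le_of_le inferInstance (iInf_le_of_le hρ le_rfl))
  have h2 : ((-Real.log R : ℝ) : EReal) ≤ V := by
    refine le_iInf fun σ => le_iInf fun hσ1 => le_iInf fun hσ => ?_
    rcases eq_or_ne (logEnergy σ) ⊤ with ht | ht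
    · rw [ht]; exact le_top
    · obtain ⟨J, hJ⟩ := exists_hasLogEnergy_of_lt_top hK hσ ht.lt_top
      rw [hJ.logEnergy_eq]
      exact_mod_cast neg_log_le_of_hasLogEnergy hR1 hR hσ hJ
  rw [logCapacity, ← hV]
  have h3 : EReal.exp (-V) ≠ ⊤ := by
    rw [Ne, EReal.exp_eq_top_iff, EReal.neg_eq_top_iff]
    intro hb
    rw [hb] at h2
    simp at h2
  rw [← ENNReal.ofReal_le_iff_le_toReal h3, ← EReal.exp_coe, EReal.coe_neg]
  exact EReal.exp_monotone (EReal.neg_le_neg_iff.2 h1)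

/-! ### Lower bound for monic polynomials via Vandermonde determinants -/

theorem map_eval_pair_pi {ι : Type*} [Fintype ι] (ρ : Measure ℝ) [IsProbabilityMeasure ρ]
    {i j : ι} (hij : i ≠ j) :
    (Measure.pi fun _ : ι => ρ).map (fun x => (x i, x j)) = ρ.prod ρ := by
  have h := ProbabilityTheory.iIndepFun_pi (μ := fun _ : ι => ρ) (X := fun _ => (id : ℝ → ℝ))
    (fun _ => aemeasurable_id)
  have h2 := (ProbabilityTheory.indepFun_iff_map_prod_eq_prod_map_map
    (measurable_pi_apply i).aemeasurable (measurable_pi_apply j).aemeasurable).1 (h.indepFun hij)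
  rw [h2, (measurePreserving_eval (fun _ : ι => ρ) i).map_eq,
    (measurePreserving_eval (fun _ : ι => ρ) j).map_eq]

theorem measurePreserving_eval_pair {ι : Type*} [Fintype ι] (ρ : Measure ℝ)
    [IsProbabilityMeasure ρ] {i j : ι} (hij : i ≠ j) :
    MeasurePreserving (fun x : ι → ℝ => (x i, x j)) (Measure.pi fun _ : ι => ρ) (ρ.prod ρ) :=
  ⟨by fun_prop, map_eval_pair_pi ρ hij⟩

theorem sum_card_Ioi (N : ℕ) :
    ∑ i : Fin N, ((Finset.Ioi i).card : ℝ) = N * (N - 1) / 2 := by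
  have h : ∀ i : Fin N, ((Finset.Ioi i).card : ℝ) = N - 1 - (i : ℕ) := by
    intro i
    have := i.2
    rw [Fin.card_Ioi, Nat.cast_sub (by omega), Nat.cast_sub (by omega)]
    simp
  simp_rw [h]
  rw [Fin.sum_univ_eq_sum_range (fun i : ℕ => (N : ℝ) - 1 - i) N, Finset.sum_sub_distrib,
    Finset.sum_const, Finset.card_range, nsmul_eq_mul]
  have h2 : ∑ i ∈ Finset.range N, (i : ℝ) = N * (N - 1) / 2 := by
    induction N with
    | zero => simp
    | succ n ih => rw [Finset.sum_range_succ, ih (fun i => by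
        have := i.2
        rw [Fin.card_Ioi, Nat.cast_sub (by omega), Nat.cast_sub (by omega)]; simp)]; push_cast; ring
  rw [h2]; ring

/-- Some configuration of points has at most the average discrete logarithmic energy. -/
theorem HasLogEnergy.exists_points {ρ : Measure ℝ} [IsProbabilityMeasure ρ] {I : ℝ}
    (h : HasLogEnergy ρ I) {K : Set ℝ} (hK : ρ Kᶜ = 0) (N : ℕ) :
    ∃ x : Fin N → ℝ, (∀ i, x i ∈ K) ∧ Function.Injective x ∧
      ∑ i, ∑ j ∈ Finset.Ioi i, logDist (x i, x j) ≤ N * (N - 1) / 2 * I := by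
  set π := Measure.pi fun _ : Fin N => ρ
  have hae : ∀ᵐ x ∂π, (∀ i, x i ∈ K) ∧ ∀ i j, i ≠ j → x i ≠ x j := by
    refine (ae_all_iff.2 fun i => ?_).and (ae_all_iff.2 fun i => ae_all_iff.2 fun j => ?_)
    · exact (measurePreserving_eval (fun _ : Fin N => ρ) i).quasiMeasurePreserving.ae
        (p := fun x => x ∈ K) hK
    · by_cases hij : i = j
      · simp [hij]
      · filter_upwards [(measurePreserving_eval_pair ρ hij).quasiMeasurePreserving.ae h.ae_ne]
          with x hx _ using hx
  have hint : ∀ i : Fin N, ∀ j ∈ Finset.Ioi i, Integrable (fun x => logDist (x i, x j)) π :=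
    fun i j hj => (measurePreserving_eval_pair ρ (Finset.mem_Ioi.1 hj).ne).integrable_comp_of_integrable
      h.integrable
  have hval : ∀ i : Fin N, ∀ j ∈ Finset.Ioi i, ∫ x, logDist (x i, x j) ∂π = I := by
    intro i j hj
    rw [← h.integral_eq, ← map_eval_pair_pi ρ (Finset.mem_Ioi.1 hj).ne,
      integral_map (by fun_prop) measurable_logDist.aestronglyMeasurable]
  have hint' : ∀ i ∈ Finset.univ, Integrable (fun x => ∑ j ∈ Finset.Ioi i, logDist (x i, x j)) π :=
    fun i _ => integrable_finsetSum _ (hint i)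
  obtain ⟨x, hx, hle⟩ := exists_notMem_null_le_integral (integrable_finsetSum _ hint') hae
  simp only [Set.mem_compl_iff, not_not] at hx
  refine ⟨x, hx.1, fun i j hij => by_contra fun hne => hx.2 i j hne hij, hle.trans_eq ?_⟩
  rw [integral_finsetSum _ hint', ← sum_card_Ioi, Finset.sum_mul]
  refine Finset.sum_congr rfl fun i _ => ?_
  rw [integral_finsetSum _ (hint i), Finset.sum_congr rfl (hval i), Finset.sum_const, nsmul_eq_mul]

/-- The crude Leibniz bound suffices: `log N!` is `O(N log N)`, negligible against the order `N ^ 2`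
of the energy sums. -/
theorem abs_det_le_factorial_mul_prod {N : ℕ} (A : Matrix (Fin N) (Fin N) ℝ) (B : Fin N → ℝ)
    (hB : ∀ i j, |A i j| ≤ B j) : |A.det| ≤ N.factorial * ∏ j, B j := by
  rw [← Matrix.det_transpose, Matrix.det_apply']
  refine (Finset.abs_sum_le_sum_abs _ _).trans ?_
  have : ∀ σ ∈ (Finset.univ : Finset (Equiv.Perm (Fin N))),
      |((Equiv.Perm.sign σ : ℤ) : ℝ) * ∏ i, A.transpose (σ i) i| ≤ ∏ j, B j := by
    intro σ _
    rw [abs_mul, Finset.abs_prod]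
    have h1 : |((Equiv.Perm.sign σ : ℤ) : ℝ)| = 1 := by
      rcases Int.units_eq_one_or (Equiv.Perm.sign σ) with h | h <;> simp [h]
    rw [h1, one_mul, ← Equiv.prod_comp σ B]
    exact Finset.prod_le_prod (fun _ _ => abs_nonneg _) fun i _ => hB _ _
  refine (Finset.sum_le_sum this).trans_eq ?_
  rw [Finset.sum_const, Finset.card_univ, Fintype.card_perm, Fintype.card_fin, nsmul_eq_mul]

theorem sum_range_mul_div (n k : ℕ) :
    ∑ j ∈ Finset.range (n * k), ((j / n : ℕ) : ℝ) = n * (k * (k - 1) / 2) := by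
  rcases Nat.eq_zero_or_pos n with rfl | hn
  · simp
  induction k with
  | zero => simp
  | succ k ih =>
    rw [Nat.mul_succ, Finset.sum_range_add, ih]
    have : ∀ i ∈ Finset.range n, (((n * k + i) / n : ℕ) : ℝ) = k := by
      intro i hi
      rw [Nat.mul_add_div hn, Nat.div_eq_of_lt (Finset.mem_range.1 hi), add_zero]
    rw [Finset.sum_congr rfl this]
    simp
    ring

theorem monic_natDegree_pow_mul_X_pow {P : Polynomial ℝ} {n : ℕ} (hP : P.Monic)
    (hn : P.natDegree = n) (j : ℕ) :
    (P ^ (j / n) * Polynomial.X ^ (j % n)).Monic ∧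
      (P ^ (j / n) * Polynomial.X ^ (j % n)).natDegree = j := by
  refine ⟨(hP.pow _).mul (Polynomial.monic_X_pow _), ?_⟩
  rw [(hP.pow _).natDegree_mul (Polynomial.monic_X_pow _), hP.natDegree_pow, hn,
    Polynomial.natDegree_X_pow, mul_comm]
  exact Nat.div_add_mod j n

/-- A configuration of small discrete energy has a large Vandermonde determinant. The same
determinant is obtained from any basis of monic polynomials of degrees `0, 1, ...`; using as many
powers of `P` as possible makes its entries small. -/
theorem HasLogEnergy.neg_mul_le_of_abs_eval_le {ρ : Measure ℝ} [IsProbabilityMeasure ρ] {I : ℝ}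
    (h : HasLogEnergy ρ I) {K : Set ℝ} (hK : ρ Kᶜ = 0) {P : Polynomial ℝ} {n : ℕ} (hP : P.Monic)
    (hn : P.natDegree = n) {R t : ℝ} (hR : 1 ≤ R) (ht : 0 < t) (hKR : ∀ x ∈ K, |x| ≤ R)
    (hKt : ∀ x ∈ K, |P.eval x| ≤ t) (k : ℕ) (hk : 0 < n * k) :
    -((n * k : ℕ) * ((n * k : ℕ) - 1) / 2 * I) ≤ (n * k : ℕ) * Real.log (n * k : ℕ)
      + (n * (k * (k - 1) / 2) * Real.log t + (n * k : ℕ) * (n * Real.log R)) := by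
  set N := n * k with hN
  obtain ⟨x, hxK, hinj, hx⟩ := h.exists_points hK N
  have hdet := Matrix.det_eval_matrixOfPolynomials_eq_det_vandermonde x
    (fun j : Fin N => P ^ ((j : ℕ) / n) * Polynomial.X ^ ((j : ℕ) % n))
    (fun j => (monic_natDegree_pow_mul_X_pow hP hn j).2)
    (fun j => (monic_natDegree_pow_mul_X_pow hP hn j).1)
  have hn0 : 0 < n := Nat.pos_of_mul_pos_right hk
  have hR0 : 0 < R := by linarith
  have hbound := abs_det_le_factorial_mul_prod (B := fun j : Fin N => t ^ ((j : ℕ) / n) * R ^ n)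
    (A := Matrix.of fun i j : Fin N =>
      (P ^ ((j : ℕ) / n) * Polynomial.X ^ ((j : ℕ) % n)).eval (x i)) (by
    intro i j
    simp only [Matrix.of_apply, Polynomial.eval_mul, Polynomial.eval_pow, Polynomial.eval_X,
      abs_mul, abs_pow]
    refine mul_le_mul (pow_le_pow_left₀ (abs_nonneg _) (hKt _ (hxK i)) _) ?_ (by positivity)
      (by positivity)
    exact (pow_le_pow_left₀ (abs_nonneg _) (hKR _ (hxK i)) _).trans
      (pow_le_pow_right₀ hR (Nat.mod_lt _ hn0).le))
  have hlogdet : Real.log |(Matrix.vandermonde x).det|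
      = -∑ i, ∑ j ∈ Finset.Ioi i, logDist (x i, x j) := by
    have hne : ∀ i j : Fin N, j ∈ Finset.Ioi i → |x j - x i| ≠ 0 := fun i j hj =>
      abs_ne_zero.2 (sub_ne_zero.2 (hinj.ne (Finset.mem_Ioi.1 hj).ne'))
    rw [Matrix.det_vandermonde, Finset.abs_prod]
    simp_rw [Finset.abs_prod]
    rw [Real.log_prod fun i _ => Finset.prod_ne_zero_iff.2 (hne i), ← Finset.sum_neg_distrib]
    refine Finset.sum_congr rfl fun i _ => ?_
    rw [Real.log_prod (hne i), ← Finset.sum_neg_distrib]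
    refine Finset.sum_congr rfl fun j _ => ?_
    rw [logDist, neg_neg, dist_comm, Real.dist_eq]
  have hpos : 0 < |(Matrix.vandermonde x).det| :=
    abs_pos.2 (Matrix.det_vandermonde_ne_zero_iff.2 hinj)
  rw [hdet] at hpos hlogdet
  have hlog := Real.log_le_log hpos hbound
  have hprod : ∀ j ∈ (Finset.univ : Finset (Fin N)), t ^ ((j : ℕ) / n) * R ^ n ≠ 0 :=
    fun j _ => by positivity
  have hfac : Real.log (N.factorial : ℝ) ≤ N * Real.log N := by
    rw [← Real.log_pow]
    refine Real.log_le_log (by positivity) ?_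
    exact_mod_cast Nat.factorial_le_pow N
  have hsum : ∑ j : Fin N, Real.log (t ^ ((j : ℕ) / n) * R ^ n)
      = n * (k * (k - 1) / 2) * Real.log t + N * (n * Real.log R) := by
    rw [← sum_range_mul_div, Fin.sum_univ_eq_sum_range
      (fun j : ℕ => Real.log (t ^ (j / n) * R ^ n)) N, Finset.sum_mul]
    have : ∀ j ∈ Finset.range N, Real.log (t ^ (j / n) * R ^ n)
        = ((j / n : ℕ) : ℝ) * Real.log t + n * Real.log R := by
      intro j _
      rw [Real.log_mul (by positivity) (by positivity), Real.log_pow, Real.log_pow]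
    rw [Finset.sum_congr rfl this, Finset.sum_add_distrib, Finset.sum_const, Finset.card_range,
      nsmul_eq_mul]
  rw [hlogdet, Real.log_mul (by positivity) (Finset.prod_ne_zero_iff.2 hprod),
    Real.log_prod hprod, hsum] at hlog
  linarith

/-- A monic polynomial of degree `n` bounded by `t` on a set carrying a probability measure of
energy `I` satisfies `t ≥ exp (-n I)`. -/
theorem HasLogEnergy.neg_mul_le_log {ρ : Measure ℝ} [IsProbabilityMeasure ρ] {I : ℝ}
    (h : HasLogEnergy ρ I) {K : Set ℝ} (hK : ρ Kᶜ = 0) {P : Polynomial ℝ} {n : ℕ} (hP : P.Monic)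
    (hn : P.natDegree = n) (hn0 : 0 < n) {R t : ℝ} (ht : 0 < t)
    (hKR : ∀ x ∈ K, |x| ≤ R) (hKt : ∀ x ∈ K, |P.eval x| ≤ t) : -(n * I) ≤ Real.log t := by
  have hmain := fun k => h.neg_mul_le_of_abs_eval_le hK hP hn (le_max_right R 1) ht
    (fun x hx => (hKR x hx).trans (le_max_left _ _)) hKt k
  set L := Real.log (max R 1)
  have hn' : (0 : ℝ) < n := by exact_mod_cast hn0
  have hk0 : Tendsto (fun k : ℕ => ((k : ℝ))⁻¹) atTop (𝓝 0) := tendsto_inv_atTop_nhds_zero_nat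
  have hlog : Tendsto (fun k : ℕ => Real.log (k : ℝ) * (k : ℝ)⁻¹) atTop (𝓝 0) := by
    have := (Real.isLittleO_log_id_atTop.tendsto_div_nhds_zero).comp
      (tendsto_natCast_atTop_atTop (R := ℝ))
    simpa [Function.comp_def, div_eq_mul_inv] using this
  have hl : Tendsto (fun k : ℕ => -((n - (k : ℝ)⁻¹) / 2 * I)) atTop (𝓝 (-((n - 0) / 2 * I))) :=
    (((tendsto_const_nhds.sub hk0).div_const 2).mul_const I).neg
  have hr : Tendsto (fun k : ℕ => Real.log n * (k : ℝ)⁻¹ + Real.log k * (k : ℝ)⁻¹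
      + ((1 - (k : ℝ)⁻¹) / 2 * Real.log t + n * L * (k : ℝ)⁻¹)) atTop
      (𝓝 (Real.log n * 0 + 0 + ((1 - 0) / 2 * Real.log t + n * L * 0))) :=
    ((hk0.const_mul _).add hlog).add
      ((((tendsto_const_nhds.sub hk0).div_const 2).mul_const _).add (hk0.const_mul _))
  have := le_of_tendsto_of_tendsto hl hr (by
    filter_upwards [eventually_gt_atTop 0] with k hk
    have hk' : (0 : ℝ) < k := by exact_mod_cast hk
    have h1 := hmain k (by positivity)
    push_cast at h1
    rw [Real.log_mul hn'.ne' hk'.ne'] at h1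
    -- After division by `n k ^ 2` the factorial and the powers of `R` contribute `O(log k / k)`,
    -- and the limit reads `-n I / 2 ≤ log t / 2`.
    have h2 : 0 < (n : ℝ) * k * k := by positivity
    refine le_of_mul_le_mul_left (le_trans (le_of_eq ?_) (h1.trans (le_of_eq ?_))) h2
    · field_simp
    · field_simp)
  linarith

/-! ### Leja points and monic polynomials small on a compact set -/

/-- The logarithmic kernel truncated at distance `ε`. -/
noncomputable def truncLogDist (ε : ℝ) (p : ℝ × ℝ) : ℝ := -Real.log (max (dist p.1 p.2) ε)

theorem continuous_truncLogDist {ε : ℝ} (hε : 0 < ε) : Continuous (truncLogDist ε) := by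
  unfold truncLogDist
  exact (Continuous.log (by fun_prop) fun p => (lt_max_of_lt_right hε).ne').neg

theorem truncLogDist_le_logDist {ε : ℝ} {p : ℝ × ℝ} (hp : p.1 ≠ p.2) :
    truncLogDist ε p ≤ logDist p :=
  neg_le_neg (Real.log_le_log (dist_pos.2 hp) (le_max_left _ _))

theorem truncLogDist_of_le {ε : ℝ} {p : ℝ × ℝ} (hp : ε ≤ dist p.1 p.2) :
    truncLogDist ε p = logDist p := by
  rw [truncLogDist, max_eq_left hp, logDist]

theorem truncLogDist_self {ε : ℝ} (hε : 0 < ε) (x : ℝ) : truncLogDist ε (x, x) = -Real.log ε := by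
  simp [truncLogDist, max_eq_right hε.le]

/-- Fatou's lemma as the truncation tends to `0`, after adding `log R` to make the kernels
nonnegative. On the diagonal the truncated kernels tend to `+∞` while `logDist` is `0` by
convention, so the diagonal must first be shown null. -/
theorem exists_hasLogEnergy_of_truncLogDist {σ : Measure ℝ} [IsProbabilityMeasure σ] {K : Set ℝ}
    (hK : Bornology.IsBounded K) (hσ : σ Kᶜ = 0) {A : ℝ}
    (hA : ∀ ε : ℝ, 0 < ε → ε ≤ 1 → ∫ p, truncLogDist ε p ∂σ.prod σ ≤ A) :
    ∃ I ≤ A, HasLogEnergy σ I := by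
  obtain ⟨R, hR1, hR⟩ := exists_dist_le_of_isBounded hK
  have hR0 : 0 < R := by linarith
  have hmem := ae_prod_mem hσ
  set e : ℕ → ℝ := fun n => 1 / ((n : ℝ) + 1)
  have he0 : ∀ n, 0 < e n := fun n => by positivity
  have he1 : ∀ n, e n ≤ 1 := fun n => by
    rw [div_le_one (by positivity)]; linarith [n.cast_nonneg (α := ℝ)]
  have helim : Tendsto e atTop (𝓝 0) := tendsto_one_div_add_atTop_nhds_zero_nat
  have hlow : ∀ n, ∀ᵐ p ∂σ.prod σ, 0 ≤ truncLogDist (e n) p + Real.log R := by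
    intro n
    filter_upwards [hmem] with p hp
    have := Real.log_le_log (lt_max_of_lt_right (he0 n))
      (max_le (hR _ hp.1 _ hp.2) ((he1 n).trans hR1))
    rw [truncLogDist]; linarith
  have hint : ∀ n, Integrable (truncLogDist (e n)) (σ.prod σ) := by
    intro n
    refine Integrable.of_bound (continuous_truncLogDist (he0 n)).aestronglyMeasurable
      (Real.log R + -Real.log (e n)) ?_
    filter_upwards [hlow n] with p hp
    have h1 := Real.log_le_log (he0 n) (le_max_right (dist p.1 p.2) (e n))
    have h2 := Real.log_nonneg hR1
    have h3 := Real.log_nonpos (he0 n).le (he1 n)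
    rw [Real.norm_eq_abs, abs_le]
    unfold truncLogDist at *
    constructor <;> linarith
  have hle : ∀ n, ∫⁻ p, ENNReal.ofReal (truncLogDist (e n) p + Real.log R) ∂σ.prod σ
      ≤ ENNReal.ofReal (A + Real.log R) := by
    intro n
    have hadd : Integrable (fun p => truncLogDist (e n) p + Real.log R) (σ.prod σ) :=
      (hint n).add (integrable_const _)
    rw [← ofReal_integral_eq_lintegral_ofReal hadd (hlow n), integral_add (hint n) (integrable_const _)]
    apply ENNReal.ofReal_le_ofReal
    simpa using hA _ (he0 n) (he1 n)
  have hFatou : ∫⁻ p, liminf (fun n => ENNReal.ofReal (truncLogDist (e n) p + Real.log R)) atTop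
      ∂σ.prod σ ≤ ENNReal.ofReal (A + Real.log R) := by
    refine (lintegral_liminf_le fun n => ?_).trans ?_
    · exact ((continuous_truncLogDist (he0 n)).measurable.add_const _).ennreal_ofReal
    · refine (liminf_le_liminf (Eventually.of_forall hle)).trans ?_
      simp
  have hdiag : ∀ p : ℝ × ℝ, p.1 = p.2 →
      liminf (fun n => ENNReal.ofReal (truncLogDist (e n) p + Real.log R)) atTop = ⊤ := by
    intro p hp
    have hp' : p = (p.1, p.1) := Prod.ext rfl hp.symm
    refine Tendsto.liminf_eq (ENNReal.tendsto_ofReal_atTop.comp ?_)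
    refine tendsto_atTop_add_const_right _ _ ?_
    have : (fun n => truncLogDist (e n) p) = fun n => -Real.log (e n) := by
      funext n; rw [hp', truncLogDist_self (he0 n)]
    rw [this]
    refine tendsto_neg_atBot_atTop.comp (Real.tendsto_log_nhdsGT_zero.comp ?_)
    exact tendsto_nhdsWithin_iff.2 ⟨helim, Eventually.of_forall he0⟩
  have hoff : ∀ p : ℝ × ℝ, p.1 ≠ p.2 →
      liminf (fun n => ENNReal.ofReal (truncLogDist (e n) p + Real.log R)) atTop
        = ENNReal.ofReal (logDist p + Real.log R) := by
    intro p hp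
    refine Tendsto.liminf_eq (tendsto_const_nhds.congr' ?_)
    filter_upwards [helim.eventually_lt_const (dist_pos.2 hp)] with n hn
    rw [truncLogDist_of_le hn.le]
  have hne : ∀ᵐ p ∂σ.prod σ, p.1 ≠ p.2 := by
    have hmeas : Measurable fun p : ℝ × ℝ =>
        liminf (fun n => ENNReal.ofReal (truncLogDist (e n) p + Real.log R)) atTop :=
      Measurable.liminf fun n =>
        ((continuous_truncLogDist (he0 n)).measurable.add_const _).ennreal_ofReal
    filter_upwards [ae_lt_top hmeas (ne_top_of_le_ne_top ENNReal.ofReal_ne_top hFatou)] with p hp h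
    exact hp.ne (hdiag p h)
  have hlow' : ∀ᵐ p ∂σ.prod σ, 0 ≤ logDist p + Real.log R := by
    filter_upwards [hmem] with p hp
    linarith [neg_log_le_logDist hR1 (hR _ hp.1 _ hp.2)]
  have hlint : ∫⁻ p, ENNReal.ofReal (logDist p + Real.log R) ∂σ.prod σ
      ≤ ENNReal.ofReal (A + Real.log R) := by
    refine le_trans (le_of_eq (lintegral_congr_ae ?_)) hFatou
    filter_upwards [hne] with p hp using (hoff p hp).symm
  have hint1 : Integrable (fun p => logDist p + Real.log R) (σ.prod σ) := by
    refine ⟨(measurable_logDist.add_const _).aestronglyMeasurable, ?_⟩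
    rw [hasFiniteIntegral_iff_ofReal hlow']
    exact hlint.trans_lt ENNReal.ofReal_lt_top
  have hint2 : Integrable logDist (σ.prod σ) := by
    convert hint1.sub (integrable_const (Real.log R)) using 1
    ext p; simp
  refine ⟨_, ?_, hne, hint2, rfl⟩
  rw [← ofReal_integral_eq_lintegral_ofReal hint1 hlow', integral_add hint2 (integrable_const _)]
    at hlint
  have hAR : 0 ≤ A + Real.log R := by
    have h1 := hA _ (he0 0) (he1 0)
    have h2 := integral_nonneg_of_ae (hlow 0)
    rw [integral_add (hint 0) (integrable_const _)] at h2
    simp only [integral_const, probReal_univ, smul_eq_mul, one_mul] at h2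
    linarith
  have := (ENNReal.ofReal_le_ofReal_iff hAR).1 hlint
  simpa using this

/-- The product of the linear factors at the points chosen greedily by `g`. -/
noncomputable def greedyPoly (g : Polynomial ℝ → ℝ) : ℕ → Polynomial ℝ
  | 0 => 1
  | k + 1 => greedyPoly g k * (Polynomial.X - Polynomial.C (g (greedyPoly g k)))

theorem greedyPoly_eq_prod (g : Polynomial ℝ → ℝ) (k : ℕ) :
    greedyPoly g k
      = ∏ i ∈ Finset.range k, (Polynomial.X - Polynomial.C (g (greedyPoly g i))) := by
  induction k with
  | zero => rfl
  | succ k ih => rw [Finset.prod_range_succ, ← ih, greedyPoly]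

/-- Leja's construction: apply the hypothesis to the monic polynomial whose roots are the points
already chosen. -/
theorem exists_seq_of_forall_monic {K : Set ℝ} {c : ℝ}
    (H : ∀ T : Polynomial ℝ, T.Monic → ∃ x ∈ K, c ^ T.natDegree ≤ |T.eval x|) :
    ∃ x : ℕ → ℝ, (∀ k, x k ∈ K) ∧ ∀ k, c ^ k ≤ ∏ i ∈ Finset.range k, dist (x k) (x i) := by
  have : ∀ T : Polynomial ℝ, ∃ x, T.Monic → x ∈ K ∧ c ^ T.natDegree ≤ |T.eval x| := by
    intro T
    by_cases hT : T.Monic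
    · obtain ⟨x, hx⟩ := H T hT
      exact ⟨x, fun _ => hx⟩
    · exact ⟨0, fun h => absurd h hT⟩
  choose g hg using this
  have hmon : ∀ k, (greedyPoly g k).Monic := fun k => by
    rw [greedyPoly_eq_prod]
    exact Polynomial.monic_prod_of_monic _ _ fun i _ => Polynomial.monic_X_sub_C _
  have hdeg : ∀ k, (greedyPoly g k).natDegree = k := fun k => by
    rw [greedyPoly_eq_prod, Polynomial.natDegree_prod_of_monic _ _ fun i _ => Polynomial.monic_X_sub_C _]
    simp
  refine ⟨fun k => g (greedyPoly g k), fun k => (hg _ (hmon k)).1, fun k => ?_⟩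
  have := (hg _ (hmon k)).2
  rw [hdeg] at this
  refine this.trans_eq ?_
  have heval : ∀ a, |(greedyPoly g k).eval a|
      = ∏ i ∈ Finset.range k, dist a (g (greedyPoly g i)) := fun a => by
    rw [greedyPoly_eq_prod g k, Polynomial.eval_prod, Finset.abs_prod]
    simp [Real.dist_eq]
  exact heval _

/-- The `N` diagonal terms are finite thanks to the truncation; each unordered pair is counted
twice, and the pairs with larger index `k` contribute at most `-k log c`. -/
theorem sum_truncLogDist_le {c : ℝ} (hc : 0 < c) {x : ℕ → ℝ}
    (hx : ∀ k, c ^ k ≤ ∏ i ∈ Finset.range k, dist (x k) (x i)) {ε : ℝ} (hε : 0 < ε) (N : ℕ) :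
    ∑ i ∈ Finset.range N, ∑ j ∈ Finset.range N, truncLogDist ε (x i, x j)
      ≤ N * -Real.log ε - N * (N - 1) * Real.log c := by
  have hstep : ∀ k, ∑ i ∈ Finset.range k, truncLogDist ε (x k, x i) ≤ -(k * Real.log c) := by
    intro k
    have hpos : 0 < ∏ i ∈ Finset.range k, dist (x k) (x i) := (pow_pos hc k).trans_le (hx k)
    have hne := Finset.prod_ne_zero_iff.1 hpos.ne'
    have h1 := Real.log_le_log (pow_pos hc k) (hx k)
    rw [Real.log_pow, Real.log_prod hne] at h1
    calc ∑ i ∈ Finset.range k, truncLogDist ε (x k, x i)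
        ≤ ∑ i ∈ Finset.range k, -Real.log (dist (x k) (x i)) :=
          Finset.sum_le_sum fun i hi => truncLogDist_le_logDist (dist_ne_zero.1 (hne i hi))
      _ ≤ _ := by rw [Finset.sum_neg_distrib]; linarith
  have hsymm : ∀ a b, truncLogDist ε (a, b) = truncLogDist ε (b, a) := fun a b => by
    simp only [truncLogDist, dist_comm]
  induction N with
  | zero => simp
  | succ N ih =>
    simp_rw [Finset.sum_range_succ, Finset.sum_add_distrib]
    rw [truncLogDist_self hε]
    have h1 := hstep N
    have h2 : ∑ i ∈ Finset.range N, truncLogDist ε (x i, x N) ≤ -(N * Real.log c) := by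
      simpa only [hsymm _ (x N)] using hstep N
    push_cast
    nlinarith [h1, h2, ih]

/-- The normalised counting measure of the first `n + 1` terms of a sequence. -/
noncomputable def empiricalMeasure {α : Type*} [MeasurableSpace α] (x : ℕ → α) (n : ℕ) :
    Measure α :=
  ((n : ENNReal) + 1)⁻¹ • ∑ i ∈ Finset.range (n + 1), Measure.dirac (x i)

instance {α : Type*} [MeasurableSpace α] (x : ℕ → α) (n : ℕ) :
    IsProbabilityMeasure (empiricalMeasure x n) := by
  constructor
  simp only [empiricalMeasure, Measure.smul_apply, Measure.finsetSum_apply, measure_univ,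
    Finset.sum_const, Finset.card_range, smul_eq_mul, nsmul_eq_mul, mul_one]
  push_cast
  exact ENNReal.inv_mul_cancel (by simp) (by finiteness)

theorem integral_empiricalMeasure {α : Type*} [MeasurableSpace α] (x : ℕ → α) (n : ℕ) {f : α → ℝ}
    (hf : StronglyMeasurable f) : ∫ a, f a ∂empiricalMeasure x n
      = ((n : ℝ) + 1)⁻¹ * ∑ i ∈ Finset.range (n + 1), f (x i) := by
  rw [empiricalMeasure, integral_smul_measure, integral_finsetSum_measure]
  · simp_rw [integral_dirac' f _ hf]
    simp [ENNReal.toReal_inv, ENNReal.toReal_add]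
  · exact fun i _ => (integrable_dirac' hf (by simp))

/-- Otherwise a weak limit of the empirical measures of Leja points has energy at most `-log c`.
Truncation makes the kernel continuous, so weak convergence applies to it. -/
theorem exists_monic_le_of_logCapacity_lt {K : Set ℝ} (hK : IsCompact K) {c : ℝ}
    (hcap : logCapacity K < c) (hc : 0 < c) :
    ∃ T : Polynomial ℝ, T.Monic ∧ 0 < T.natDegree ∧ ∀ x ∈ K, |T.eval x| ≤ c ^ T.natDegree := by
  by_contra! H
  have hne : K.Nonempty := by
    obtain ⟨x, hx, -⟩ := H Polynomial.X Polynomial.monic_X (by simp)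
    exact ⟨x, hx⟩
  obtain ⟨x, hxK, hx⟩ := exists_seq_of_forall_monic (K := K) (c := c) (by
    intro T hT
    rcases Nat.eq_zero_or_pos T.natDegree with h0 | h0
    · obtain ⟨x, hx⟩ := hne
      refine ⟨x, hx, ?_⟩
      rw [hT.natDegree_eq_zero.1 h0]; simp
    · obtain ⟨x, hx, h⟩ := H T hT h0
      exact ⟨x, hx, h.le⟩)
  have : CompactSpace K := isCompact_iff_compactSpace.1 hK
  set y : ℕ → K := fun k => ⟨x k, hxK k⟩
  set ν : ℕ → ProbabilityMeasure K := fun n => ⟨empiricalMeasure y n, inferInstance⟩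
  -- A limit along a free ultrafilter replaces a weakly convergent subsequence.
  set U : Ultrafilter ℕ := hyperfilter ℕ
  obtain ⟨ρ, -, hρ⟩ := isCompact_univ.ultrafilter_le_nhds (U.map ν) (by simp)
  have hρ' : Tendsto ν U (𝓝 ρ) := hρ
  have hUtop : (U : Filter ℕ) ≤ atTop := by
    rw [← Nat.cofinite_eq_atTop]; exact hyperfilter_le_cofinite
  have hprod : Tendsto (fun n => (ν n).prod (ν n)) U (𝓝 (ρ.prod ρ)) :=
    (ProbabilityMeasure.continuous_prod.tendsto (ρ, ρ)).comp (hρ'.prodMk_nhds hρ')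
  rw [ProbabilityMeasure.tendsto_iff_forall_integral_tendsto] at hprod
  set σ : Measure ℝ := (ρ : Measure K).map Subtype.val
  have : IsProbabilityMeasure σ :=
    Measure.isProbabilityMeasure_map measurable_subtype_coe.aemeasurable
  have hσK : σ Kᶜ = 0 := by
    rw [Measure.map_apply measurable_subtype_coe hK.measurableSet.compl]
    convert measure_empty (μ := (ρ : Measure K))
    ext z; simp
  obtain ⟨I, hI, hE⟩ := exists_hasLogEnergy_of_truncLogDist (A := -Real.log c) hK.isBounded hσK (by
    intro ε hε _
    set f : BoundedContinuousFunction (K × K) ℝ := BoundedContinuousFunction.mkOfCompact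
      ⟨fun p => truncLogDist ε (p.1, p.2), (continuous_truncLogDist hε).comp (by fun_prop)⟩
    have h1 : ∫ p, truncLogDist ε p ∂σ.prod σ
        = ∫ p, f p ∂((ρ.prod ρ : ProbabilityMeasure (K × K)) : Measure (K × K)) := by
      rw [ProbabilityMeasure.toMeasure_prod, Measure.map_prod_map _ _ measurable_subtype_coe
        measurable_subtype_coe, integral_map (by fun_prop)
        (continuous_truncLogDist hε).aestronglyMeasurable]
      rfl
    rw [h1]
    have h2 : Tendsto (fun n : ℕ => ((n : ℝ) + 1)⁻¹ * -Real.log ε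
        - (1 - ((n : ℝ) + 1)⁻¹) * Real.log c) U (𝓝 (0 * -Real.log ε - (1 - 0) * Real.log c)) := by
      have h3 : Tendsto (fun n : ℕ => ((n : ℝ) + 1)⁻¹) U (𝓝 0) := by
        have := tendsto_one_div_add_atTop_nhds_zero_nat (𝕜 := ℝ)
        simp only [one_div] at this
        exact this.mono_left hUtop
      exact (h3.mul_const _).sub ((tendsto_const_nhds.sub h3).mul_const _)
    simp only [zero_mul, sub_zero, one_mul, zero_sub] at h2
    refine le_of_tendsto_of_tendsto (hprod f) h2 (Eventually.of_forall fun n => ?_)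
    have h4 : ∫ p, f p ∂(((ν n).prod (ν n) : ProbabilityMeasure (K × K)) : Measure (K × K))
        = ((n : ℝ) + 1)⁻¹ * ∑ i ∈ Finset.range (n + 1), (((n : ℝ) + 1)⁻¹
          * ∑ j ∈ Finset.range (n + 1), truncLogDist ε (x i, x j)) := by
      rw [ProbabilityMeasure.toMeasure_prod, integral_prod _ (f.integrable _)]
      change ∫ a, ∫ b, f (a, b) ∂empiricalMeasure y n ∂empiricalMeasure y n = _
      have h5 : ∀ a : K, ∫ b, f (a, b) ∂empiricalMeasure y n
          = ((n : ℝ) + 1)⁻¹ * ∑ j ∈ Finset.range (n + 1), truncLogDist ε (a, x j) := fun a =>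
        integral_empiricalMeasure y n (f := fun b => f (a, b))
          (f.continuous.comp (by fun_prop)).stronglyMeasurable
      simp_rw [h5]
      refine integral_empiricalMeasure y n (Continuous.stronglyMeasurable ?_)
      refine continuous_const.mul (continuous_finsetSum _ fun j _ => ?_)
      exact (continuous_truncLogDist hε).comp (by fun_prop)
    simp only
    rw [h4, ← Finset.mul_sum]
    have h6 := sum_truncLogDist_le hc hx hε (n + 1)
    have hn : 0 < ((n : ℝ) + 1)⁻¹ := by positivity
    calc _ ≤ ((n : ℝ) + 1)⁻¹ * (((n : ℝ) + 1)⁻¹ * (((n + 1 : ℕ) : ℝ) * -Real.log ε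
          - ((n + 1 : ℕ) : ℝ) * (((n + 1 : ℕ) : ℝ) - 1) * Real.log c)) := by gcongr
      _ = _ := by push_cast; field_simp)
  have := hE.exp_neg_le_logCapacity hK.isBounded hσK
  have h7 : c ≤ Real.exp (-I) := by
    rw [← Real.log_le_iff_le_exp hc]; linarith
  linarith

/-! ### Monic orthogonal polynomials: existence and extremality -/

theorem integrable_eval_of_isCompact_support {μ : Measure ℝ} [IsFiniteMeasure μ]
    (hμ : IsCompact μ.support) (P : Polynomial ℝ) : Integrable (fun x => P.eval x) μ := by
  obtain ⟨B, hB⟩ := hμ.exists_bound_of_continuousOn P.continuous.continuousOn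
  refine Integrable.of_bound P.continuous.aestronglyMeasurable B ?_
  filter_upwards [Measure.support_mem_ae] with x hx using hB x hx

theorem integrable_eval_mul_of_isCompact_support {μ : Measure ℝ} [IsFiniteMeasure μ]
    (hμ : IsCompact μ.support) (P Q : Polynomial ℝ) :
    Integrable (fun x => P.eval x * Q.eval x) μ := by
  simpa only [Polynomial.eval_mul] using integrable_eval_of_isCompact_support hμ (P * Q)

/-- Gram–Schmidt orthogonalisation of the monomials in `L²(μ)`. Polynomials of zero norm are
orthogonal to everything and get the coefficient `0`. -/
noncomputable def monicOrthoPoly (μ : Measure ℝ) (n : ℕ) : Polynomial ℝ :=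
  Polynomial.X ^ n + -∑ k : Fin n, Polynomial.C
    ((∫ x, x ^ n * (monicOrthoPoly μ k).eval x ∂μ) / ∫ x, (monicOrthoPoly μ k).eval x ^ 2 ∂μ)
      * monicOrthoPoly μ k
termination_by n
decreasing_by all_goals exact k.2

theorem degree_monicOrthoPoly (μ : Measure ℝ) (n : ℕ) :
    (monicOrthoPoly μ n).Monic ∧ (monicOrthoPoly μ n).degree = n := by
  induction n using Nat.strong_induction_on with
  | _ n ih =>
    rw [monicOrthoPoly]
    set q := ∑ k : Fin n, Polynomial.C ((∫ x, x ^ n * (monicOrthoPoly μ k).eval x ∂μ)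
      / ∫ x, (monicOrthoPoly μ k).eval x ^ 2 ∂μ) * monicOrthoPoly μ k with hq
    have hdeg : (-q).degree < (n : WithBot ℕ) := by
      rw [Polynomial.degree_neg]
      refine (Polynomial.degree_sum_le _ _).trans_lt
        ((Finset.sup_lt_iff (WithBot.bot_lt_coe n)).2 fun k _ => ?_)
      rw [Polynomial.C_mul']
      refine (Polynomial.degree_smul_le _ _).trans_lt ?_
      rw [(ih k k.2).2]
      exact WithBot.coe_lt_coe.2 k.2
    refine ⟨Polynomial.monic_X_pow_add hdeg, ?_⟩
    rw [Polynomial.degree_add_eq_left_of_degree_lt, Polynomial.degree_X_pow]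
    rwa [Polynomial.degree_X_pow]

/-- Such a `P` vanishes almost everywhere. This covers measures with finite support, where
Gram–Schmidt divides by zero. -/
theorem integral_eval_mul_eq_zero_of_sq {μ : Measure ℝ} [IsFiniteMeasure μ]
    (hμ : IsCompact μ.support) {P : Polynomial ℝ} (hP : ∫ x, P.eval x ^ 2 ∂μ = 0) (f : ℝ → ℝ) :
    ∫ x, f x * P.eval x ∂μ = 0 := by
  have hint : Integrable (fun x => P.eval x ^ 2) μ := by
    simpa only [sq] using integrable_eval_mul_of_isCompact_support hμ P P
  rw [integral_eq_zero_iff_of_nonneg (fun x => sq_nonneg _) hint] at hP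
  refine integral_eq_zero_of_ae ?_
  filter_upwards [hP] with x hx
  have : P.eval x = 0 := by simpa using hx
  simp [this]

theorem integral_monicOrthoPoly_mul_of_lt {μ : Measure ℝ} [IsFiniteMeasure μ]
    (hμ : IsCompact μ.support) (n m : ℕ) (hmn : m < n) :
    ∫ x, (monicOrthoPoly μ n).eval x * (monicOrthoPoly μ m).eval x ∂μ = 0 := by
  induction n using Nat.strong_induction_on generalizing m with
  | _ n ih =>
    set p := monicOrthoPoly μ
    set c : Fin n → ℝ := fun k => (∫ x, x ^ n * (p k).eval x ∂μ) / ∫ x, (p k).eval x ^ 2 ∂μ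
    have hp : ∀ x, (p n).eval x * (p m).eval x
        = x ^ n * (p m).eval x - ∑ k, c k * ((p k).eval x * (p m).eval x) := by
      intro x
      have : p n = Polynomial.X ^ n + -∑ k : Fin n, Polynomial.C (c k) * p k := by
        change monicOrthoPoly μ n = _
        rw [monicOrthoPoly]
      rw [this]
      simp only [Polynomial.eval_add, Polynomial.eval_neg, Polynomial.eval_finsetSum,
        Polynomial.eval_mul, Polynomial.eval_C, Polynomial.eval_pow, Polynomial.eval_X]
      rw [add_mul, neg_mul, Finset.sum_mul, sub_eq_add_neg]
      simp only [mul_assoc]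
    have hi1 : Integrable (fun x => x ^ n * (p m).eval x) μ := by
      simpa using integrable_eval_mul_of_isCompact_support hμ (Polynomial.X ^ n) (p m)
    have hi2 : ∀ k ∈ (Finset.univ : Finset (Fin n)),
        Integrable (fun x => c k * ((p k).eval x * (p m).eval x)) μ :=
      fun k _ => (integrable_eval_mul_of_isCompact_support hμ _ _).const_mul _
    simp_rw [hp]
    rw [integral_sub hi1 (integrable_finsetSum _ hi2), integral_finsetSum _ hi2,
      Finset.sum_eq_single (⟨m, hmn⟩ : Fin n)]
    · rw [integral_const_mul]
      simp only [c, ← sq]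
      by_cases h0 : ∫ x, (p m).eval x ^ 2 ∂μ = 0
      · rw [h0, integral_eval_mul_eq_zero_of_sq hμ h0]; simp
      · rw [div_mul_cancel₀ _ h0, sub_self]
    · intro k _ hk
      rw [integral_const_mul]
      rcases lt_or_gt_of_ne (fun h => hk (Fin.ext h) : (k : ℕ) ≠ m) with h | h
      · simp_rw [mul_comm ((p k).eval _)]
        rw [ih m hmn k h, mul_zero]
      · rw [ih k k.2 m h, mul_zero]
    · simp

theorem isMonicOrthogonalSeq_monicOrthoPoly {μ : Measure ℝ} [IsFiniteMeasure μ]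
    (hμ : IsCompact μ.support) : IsMonicOrthogonalSeq μ (monicOrthoPoly μ) where
  monic n := (degree_monicOrthoPoly μ n).1
  natDegree_eq n := Polynomial.natDegree_eq_of_degree_eq_some (degree_monicOrthoPoly μ n).2
  orthogonal n m hnm := by
    rcases lt_or_gt_of_ne hnm with h | h
    · simp_rw [mul_comm ((monicOrthoPoly μ n).eval _)]
      exact integral_monicOrthoPoly_mul_of_lt hμ m n h
    · exact integral_monicOrthoPoly_mul_of_lt hμ n m h

/-- The `P j` with `j < d` span the polynomials of degree below `d`; the induction strips off the
leading term with a multiple of `P d`. -/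
theorem IsMonicOrthogonalSeq.integral_mul_eq_zero {μ : Measure ℝ} [IsFiniteMeasure μ]
    (hμ : IsCompact μ.support) {P : ℕ → Polynomial ℝ} (hP : IsMonicOrthogonalSeq μ P) (n d : ℕ)
    (hd : d ≤ n) (q : Polynomial ℝ) (hq : q.degree < d) :
    ∫ x, q.eval x * (P n).eval x ∂μ = 0 := by
  induction d generalizing q with
  | zero =>
    have : q = 0 := by
      rw [← Polynomial.degree_eq_bot]
      exact Nat.WithBot.lt_zero_iff.1 hq
    simp [this]
  | succ d ih =>
    set q' := q - Polynomial.C (q.coeff d) * P d with hq'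
    have hdeg : q'.degree < (d : WithBot ℕ) := by
      rw [Polynomial.degree_lt_iff_coeff_zero] at hq ⊢
      intro m hm
      rw [hq', Polynomial.coeff_sub, Polynomial.coeff_C_mul]
      rcases hm.eq_or_lt with rfl | hm
      · have := (hP.monic d).coeff_natDegree
        rw [hP.natDegree_eq] at this
        rw [this]; ring
      · rw [hq m hm, Polynomial.coeff_eq_zero_of_natDegree_lt ((hP.natDegree_eq d).trans_lt hm)]; ring
    have heq : ∀ x, q.eval x * (P n).eval x
        = q'.eval x * (P n).eval x + q.coeff d * ((P d).eval x * (P n).eval x) := by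
      intro x
      rw [hq', Polynomial.eval_sub, Polynomial.eval_mul, Polynomial.eval_C]; ring
    simp_rw [heq]
    rw [integral_add (integrable_eval_mul_of_isCompact_support hμ _ _)
      ((integrable_eval_mul_of_isCompact_support hμ _ _).const_mul _), ih (by omega) q' hdeg,
      integral_const_mul, hP.orthogonal d n (by omega)]
    simp

/-- Orthogonal polynomials minimise the norm among the monic polynomials of their degree. -/
theorem IsMonicOrthogonalSeq.polyL2Norm_le {μ : Measure ℝ} [IsFiniteMeasure μ]
    (hμ : IsCompact μ.support) {P : ℕ → Polynomial ℝ} (hP : IsMonicOrthogonalSeq μ P) (n : ℕ)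
    {Q : Polynomial ℝ} (hQ : Q.Monic) (hQn : Q.natDegree = n) :
    polyL2Norm μ (P n) ≤ polyL2Norm μ Q := by
  refine Real.sqrt_le_sqrt ?_
  have hdeg : (Q - P n).degree < (n : WithBot ℕ) := by
    have h1 : Q.degree = (n : WithBot ℕ) := by
      rw [Polynomial.degree_eq_natDegree hQ.ne_zero, hQn]
    have h2 : (P n).degree = (n : WithBot ℕ) := by
      rw [Polynomial.degree_eq_natDegree (hP.monic n).ne_zero, hP.natDegree_eq]
    rw [← h1]
    exact Polynomial.degree_sub_lt_left (h1.trans h2.symm) hQ.ne_zero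
      (by rw [hQ.leadingCoeff, (hP.monic n).leadingCoeff])
  have h0 := hP.integral_mul_eq_zero hμ n n le_rfl _ hdeg
  have heq : ∀ x, Q.eval x ^ 2 = (P n).eval x ^ 2
      + ((Q - P n).eval x * (Q - P n).eval x + 2 * ((Q - P n).eval x * (P n).eval x)) := by
    intro x
    rw [Polynomial.eval_sub]; ring
  have hi := integrable_eval_mul_of_isCompact_support hμ
  have hi1 : Integrable (fun x => (Q - P n).eval x * (Q - P n).eval x
      + 2 * ((Q - P n).eval x * (P n).eval x)) μ := (hi _ _).add ((hi _ _).const_mul _)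
  simp_rw [heq]
  rw [integral_add (by simpa only [sq] using hi _ _) hi1, integral_add (hi _ _) ((hi _ _).const_mul _), integral_const_mul, h0]
  have : 0 ≤ ∫ x, (Q - P n).eval x * (Q - P n).eval x ∂μ :=
    integral_nonneg fun x => mul_self_nonneg _
  linarith

/-! ### The upper bound for the norms -/

theorem polyL2Norm_le_of_abs_eval_le {μ : Measure ℝ} [IsFiniteMeasure μ] {Q : Polynomial ℝ}
    {t : ℝ} (ht : 0 ≤ t) (hQ : ∀ x ∈ μ.support, |Q.eval x| ≤ t) :
    polyL2Norm μ Q ≤ Real.sqrt (μ.real Set.univ) * t := by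
  rw [← Real.sqrt_sq ht, ← Real.sqrt_mul measureReal_nonneg]
  refine Real.sqrt_le_sqrt ?_
  have : ∫ _x : ℝ, t ^ 2 ∂μ = μ.real Set.univ * t ^ 2 := by simp
  rw [← this]
  refine integral_mono_of_nonneg (ae_of_all _ fun x => sq_nonneg _) (integrable_const _) ?_
  filter_upwards [Measure.support_mem_ae] with x hx
  exact sq_le_sq' (abs_le.1 (hQ x hx)).1 (abs_le.1 (hQ x hx)).2

theorem logCapacity_nonneg (K : Set ℝ) : 0 ≤ logCapacity K := ENNReal.toReal_nonneg

/-- The competitor in degree `n` is `T ^ (n / k) * X ^ (n % k)`. Its remainder factor and the total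
mass cost a bounded factor, absorbed by `(c / c') ^ n`. -/
theorem IsMonicOrthogonalSeq.eventually_polyL2Norm_le {μ : Measure ℝ} [IsFiniteMeasure μ]
    (hμ : IsCompact μ.support) {P : ℕ → Polynomial ℝ} (hP : IsMonicOrthogonalSeq μ P) {c : ℝ}
    (hc : logCapacity μ.support < c) : ∀ᶠ n in atTop, polyL2Norm μ (P n) ≤ c ^ n := by
  obtain ⟨c', hc', hcc⟩ := exists_between hc
  have hc0 : 0 < c' := (logCapacity_nonneg _).trans_lt hc'
  obtain ⟨T, hT, hk, hTc⟩ := exists_monic_le_of_logCapacity_lt hμ hc' hc0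
  set k := T.natDegree with hkdef
  obtain ⟨R, hR⟩ := hμ.exists_bound_of_continuousOn (f := fun x : ℝ => x) continuousOn_id
  -- Chosen so that `|x| ≤ B * c'` on the support and `B ^ (n % k) ≤ B ^ k`.
  set B := max (R / c') 1
  have hratio : 1 < c / c' := (one_lt_div hc0).2 hcc
  filter_upwards [(tendsto_pow_atTop_atTop_of_one_lt hratio).eventually_ge_atTop
    (Real.sqrt (μ.real Set.univ) * B ^ k)] with n hn
  have hQ := monic_natDegree_pow_mul_X_pow hT hkdef.symm n
  refine (hP.polyL2Norm_le hμ n hQ.1 hQ.2).trans ?_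
  have hbound : ∀ x ∈ μ.support,
      |(T ^ (n / k) * Polynomial.X ^ (n % k)).eval x| ≤ B ^ k * c' ^ n := by
    intro x hx
    rw [Polynomial.eval_mul, Polynomial.eval_pow, Polynomial.eval_pow, Polynomial.eval_X, abs_mul,
      abs_pow, abs_pow]
    have h1 : |T.eval x| ^ (n / k) ≤ c' ^ (k * (n / k)) := by
      rw [pow_mul]; exact pow_le_pow_left₀ (abs_nonneg _) (hTc x hx) _
    have h2 : |x| ^ (n % k) ≤ B ^ k * c' ^ (n % k) := by
      have h3 : |x| ≤ B * c' := by
        rw [← div_le_iff₀ hc0]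
        exact (div_le_div_of_nonneg_right (hR x hx) hc0.le).trans (le_max_left _ _)
      refine (pow_le_pow_left₀ (abs_nonneg _) h3 _).trans ?_
      rw [mul_pow]
      refine mul_le_mul_of_nonneg_right ?_ (by positivity)
      exact pow_le_pow_right₀ (le_max_right _ _) (Nat.mod_lt _ hk).le
    calc |T.eval x| ^ (n / k) * |x| ^ (n % k)
        ≤ c' ^ (k * (n / k)) * (B ^ k * c' ^ (n % k)) :=
          mul_le_mul h1 h2 (by positivity) (by positivity)
      _ = B ^ k * c' ^ n := by
          conv_rhs => rw [← Nat.div_add_mod n k, pow_add]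
          ring
  have hB0 : 0 ≤ B := zero_le_one.trans (le_max_right _ _)
  refine (polyL2Norm_le_of_abs_eval_le (by positivity) hbound).trans ?_
  rw [← mul_assoc]
  rw [div_pow, le_div_iff₀ (by positivity)] at hn
  exact hn

/-! ### Null sets, images and conditioning of measures of finite energy -/

theorem HasLogEnergy.measure_singleton {ρ : Measure ℝ} [IsFiniteMeasure ρ] {I : ℝ}
    (h : HasLogEnergy ρ I) (x : ℝ) : ρ {x} = 0 := by
  have h1 : ρ.prod ρ ({x} ×ˢ {x}) = 0 := by
    refine measure_mono_null ?_ h.ae_ne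
    rintro ⟨p, q⟩ ⟨hp, hq⟩
    simp only [Set.mem_singleton_iff] at hp hq
    simp [hp, hq]
  rw [Measure.prod_prod] at h1
  simpa using h1

theorem HasLogEnergy.measure_countable {ρ : Measure ℝ} [IsFiniteMeasure ρ] {I : ℝ}
    (h : HasLogEnergy ρ I) {s : Set ℝ} (hs : s.Countable) : ρ s = 0 := by
  rw [← Set.biUnion_of_singleton s, measure_biUnion_null_iff hs]
  exact fun x _ => h.measure_singleton x

/-- The set is discrete in its subspace topology, and subspaces of the line are separable. Hence
finite-energy measures cannot distinguish the support from the essential support. -/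
theorem countable_setOf_not_accPt (s : Set ℝ) : {x | x ∈ s ∧ ¬AccPt x (𝓟 s)}.Countable := by
  set D := {x | x ∈ s ∧ ¬AccPt x (𝓟 s)}
  have : DiscreteTopology D := by
    rw [discreteTopology_subtype_iff]
    intro x hx
    have := hx.2
    rw [accPt_iff_frequently_nhdsNE, not_frequently] at this
    rw [← disjoint_iff, disjoint_principal_right]
    filter_upwards [this] with y hy hyD using hy hyD.1
  exact Set.countable_coe_iff.1 (TopologicalSpace.separableSpace_iff_countable.1 inferInstance)

/-- Shrinking distances by a factor no smaller than `c` adds at most `-log c` to the kernel. -/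
theorem HasLogEnergy.exists_map {ρ : Measure ℝ} [IsProbabilityMeasure ρ] {I : ℝ}
    (h : HasLogEnergy ρ I) {K K' : Set ℝ} (hK : ρ Kᶜ = 0) {T : ℝ → ℝ} (hT : Measurable T) {c : ℝ}
    (hc : 0 < c) (hTc : ∀ x ∈ K, ∀ y ∈ K, c * dist x y ≤ dist (T x) (T y))
    (hTK : ∀ x ∈ K, T x ∈ K') (hK' : Bornology.IsBounded K') :
    ∃ J ≤ I - Real.log c, HasLogEnergy (ρ.map T) J := by
  obtain ⟨R, hR1, hR⟩ := exists_dist_le_of_isBounded hK'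
  have hmp : MeasurePreserving (Prod.map T T) (ρ.prod ρ) ((ρ.map T).prod (ρ.map T)) :=
    ⟨hT.prodMap hT, (Measure.map_prod_map _ _ hT hT).symm⟩
  have hub : ∀ᵐ p ∂ρ.prod ρ, logDist (Prod.map T T p) ≤ logDist p - Real.log c := by
    filter_upwards [ae_prod_mem hK, h.ae_ne] with p hp hne
    have hd := dist_pos.2 hne
    have := Real.log_le_log (mul_pos hc hd) (hTc _ hp.1 _ hp.2)
    rw [Real.log_mul hc.ne' hd.ne'] at this
    simp only [logDist, Prod.map_fst, Prod.map_snd]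
    linarith
  have hlb : ∀ᵐ p ∂ρ.prod ρ, -Real.log R ≤ logDist (Prod.map T T p) := by
    filter_upwards [ae_prod_mem hK] with p hp
    exact neg_log_le_logDist hR1 (hR _ (hTK _ hp.1) _ (hTK _ hp.2))
  have hub_int : Integrable (fun p => logDist p - Real.log c) (ρ.prod ρ) :=
    h.integrable.sub (integrable_const _)
  have hint : Integrable (logDist ∘ Prod.map T T) (ρ.prod ρ) := by
    refine Integrable.mono' (hub_int.abs.add (integrable_const (Real.log R)))
      (measurable_logDist.comp (hT.prodMap hT)).aestronglyMeasurable ?_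
    filter_upwards [hub, hlb] with p hp1 hp2
    have h1 := Real.log_nonneg hR1
    have h2 := le_abs_self (logDist p - Real.log c)
    have h3 := abs_nonneg (logDist p - Real.log c)
    simp only [Function.comp_apply, Real.norm_eq_abs, Pi.add_apply]
    rw [abs_le]
    constructor <;> linarith
  refine ⟨_, ?_, ?_, (hmp.integrable_comp measurable_logDist.aestronglyMeasurable).1 hint, rfl⟩
  · rw [← hmp.map_eq, integral_map hmp.measurable.aemeasurable
      measurable_logDist.aestronglyMeasurable]
    refine (integral_mono_ae hint hub_int hub).trans_eq ?_
    rw [integral_sub h.integrable (integrable_const _), h.integral_eq]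
    simp
  · have hms : MeasurableSet {p : ℝ × ℝ | p.1 ≠ p.2} :=
      (measurableSet_eq_fun measurable_fst measurable_snd).compl
    rw [← hmp.map_eq, ae_map_iff hmp.measurable.aemeasurable hms]
    filter_upwards [ae_prod_mem hK, h.ae_ne] with p hp hne
    exact dist_pos.1 ((mul_pos hc (dist_pos.2 hne)).trans_le (hTc _ hp.1 _ hp.2))

/-- Off `S ×ˢ S`, a set of mass `1 - ρ(S) ^ 2`, the kernel is at least `-log R`, so discarding that
part costs at most `log R * (1 - ρ(S) ^ 2)`. -/
theorem HasLogEnergy.exists_cond {ρ : Measure ℝ} [IsProbabilityMeasure ρ] {I : ℝ}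
    (h : HasLogEnergy ρ I) {K : Set ℝ} (hK : ρ Kᶜ = 0) {R : ℝ} (hR1 : 1 ≤ R)
    (hR : ∀ x ∈ K, ∀ y ∈ K, dist x y ≤ R) {S : Set ℝ} (hS : MeasurableSet S)
    (hpos : 0 < ρ.real S) :
    ∃ J, HasLogEnergy (ProbabilityTheory.cond ρ S) J ∧
      ρ.real S ^ 2 * J ≤ I + Real.log R * (1 - ρ.real S ^ 2) := by
  have hρS : ρ S ≠ 0 := fun h0 => by simp [Measure.real, h0] at hpos
  have hprod : (ProbabilityTheory.cond ρ S).prod (ProbabilityTheory.cond ρ S)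
      = ((ρ S)⁻¹ * (ρ S)⁻¹) • (ρ.prod ρ).restrict (S ×ˢ S) := by
    rw [ProbabilityTheory.cond, Measure.prod_smul_left, Measure.prod_smul_right, smul_smul,
      Measure.prod_restrict]
  have hint := h.integrable.restrict (s := S ×ˢ S)
  refine ⟨_, ⟨?_, ?_, rfl⟩, ?_⟩
  · rw [hprod]
    exact Measure.ae_smul_measure (ae_restrict_of_ae h.ae_ne) _
  · rw [hprod]
    exact hint.smul_measure (ENNReal.mul_ne_top (ENNReal.inv_ne_top.2 hρS) (ENNReal.inv_ne_top.2 hρS))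
  · have hcompl : -Real.log R * (1 - ρ.real S ^ 2) ≤ ∫ p in (S ×ˢ S)ᶜ, logDist p ∂ρ.prod ρ := by
      have h1 : ∫ _p in (S ×ˢ S)ᶜ, -Real.log R ∂ρ.prod ρ = -Real.log R * (1 - ρ.real S ^ 2) := by
        rw [setIntegral_const, probReal_compl_eq_one_sub (hS.prod hS), measureReal_prod_prod,
          smul_eq_mul]
        ring
      rw [← h1]
      refine integral_mono_ae (integrable_const _) h.integrable.restrict (ae_restrict_of_ae ?_)
      filter_upwards [ae_prod_mem hK] with p hp
      exact neg_log_le_logDist hR1 (hR _ hp.1 _ hp.2)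
    have hsum := integral_add_compl (hS.prod hS) h.integrable
    rw [h.integral_eq] at hsum
    rw [hprod, integral_smul_measure, smul_eq_mul, ENNReal.toReal_mul, ENNReal.toReal_inv]
    change ρ.real S ^ 2 * ((ρ.real S)⁻¹ * (ρ.real S)⁻¹ * _) ≤ _
    have h2 : ρ.real S ^ 2 * ((ρ.real S)⁻¹ * (ρ.real S)⁻¹ * ∫ p in S ×ˢ S, logDist p ∂ρ.prod ρ)
        = ∫ p in S ×ˢ S, logDist p ∂ρ.prod ρ := by
      field_simp
    rw [h2]
    linarith

/-- Conditioning on a set of almost full measure raises the energy only a little, uniformly in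
the measure. -/
theorem exists_pos_forall_cond_energy_lt {R A A' : ℝ} (hR1 : 1 ≤ R) (hA' : -Real.log R ≤ A')
    (hAA : A' < A) :
    ∃ δ : ℝ, 0 < δ ∧ δ < 1 ∧ ∀ (ρ : Measure ℝ) [IsProbabilityMeasure ρ] (I : ℝ) (K S : Set ℝ),
      HasLogEnergy ρ I → I ≤ A' → ρ Kᶜ = 0 → (∀ x ∈ K, ∀ y ∈ K, dist x y ≤ R) →
      MeasurableSet S → ρ.real Sᶜ ≤ δ →
      ∃ J < A, HasLogEnergy (ProbabilityTheory.cond ρ S) J := by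
  set L := Real.log R
  have hAL : 0 < A + L := by linarith
  have h4 : 0 < 4 * (A + L) := by linarith
  -- If the new energy were at least `A`, then `s ^ 2 * (A + L) ≤ A' + L`, hence `A - A' ≤ 2 * (1 -
  -- s) * (A + L)`; this `δ` makes the right side at most `(A - A') / 2`.
  refine ⟨(A - A') / (4 * (A + L)), div_pos (by linarith) h4, ?_, ?_⟩
  · rw [div_lt_one h4]; linarith
  intro ρ _ I K S h hI hK hR hS hSδ
  set s := ρ.real S
  rw [probReal_compl_eq_one_sub hS, le_div_iff₀ h4] at hSδ
  have hs0 : 0 < s := by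
    by_contra! hs
    nlinarith
  obtain ⟨J, hJ, hJle⟩ := h.exists_cond hK hR1 hR hS hs0
  refine ⟨J, ?_, hJ⟩
  by_contra! hJA
  have hs2 : 1 - 2 * (1 - s) ≤ s ^ 2 := by nlinarith [sq_nonneg (1 - s)]
  have h5 : s ^ 2 * A ≤ s ^ 2 * J := mul_le_mul_of_nonneg_left hJA (sq_nonneg _)
  have h6 : (1 - 2 * (1 - s)) * (A + L) ≤ s ^ 2 * (A + L) :=
    mul_le_mul_of_nonneg_right hs2 hAL.le
  change s ^ 2 * J ≤ I + L * (1 - s ^ 2) at hJle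
  nlinarith

/-! ### Stability of the energy when little length is removed from the intervals -/

/-- Subtracting a small multiple of the displacement from the midpoint contracts each interval. It
has slope one inside an interval; between two intervals its variation is at most the sum of their
lengths, while the gap is positive. -/
theorem exists_displacement_lipschitz {ℓ : ℕ} {a b : Fin ℓ → ℝ} (hab : ∀ j, a j ≤ b j)
    (hdisj : Pairwise (fun i j => Disjoint (Set.Icc (a i) (b i)) (Set.Icc (a j) (b j)))) :
    ∃ (φ : ℝ → ℝ) (C : ℝ), Measurable φ ∧ 0 ≤ C ∧
      (∀ j, ∀ x ∈ Set.Icc (a j) (b j), φ x = x - (a j + b j) / 2) ∧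
      ∀ x ∈ ⋃ j, Set.Icc (a j) (b j), ∀ y ∈ ⋃ j, Set.Icc (a j) (b j),
        |φ x - φ y| ≤ C * |x - y| := by
  classical
  set φ : ℝ → ℝ := fun x =>
    ∑ j, (Set.Icc (a j) (b j)).indicator (fun x => x - (a j + b j) / 2) x
  have hφ : ∀ j, ∀ x ∈ Set.Icc (a j) (b j), φ x = x - (a j + b j) / 2 := by
    intro j x hx
    simp only [φ]
    rw [Finset.sum_eq_single j]
    · rw [Set.indicator_of_mem hx]
    · intro i _ hij
      exact Set.indicator_of_notMem (Set.disjoint_right.1 (hdisj hij) hx) _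
    · simp
  have hpair : ∀ i j, ∃ C : ℝ, 0 ≤ C ∧ ∀ x ∈ Set.Icc (a i) (b i), ∀ y ∈ Set.Icc (a j) (b j),
      |φ x - φ y| ≤ C * |x - y| := by
    intro i j
    by_cases hij : i = j
    · subst hij
      refine ⟨1, zero_le_one, fun x hx y hy => ?_⟩
      rw [hφ i x hx, hφ i y hy, one_mul, sub_sub_sub_cancel_right]
    · have hgap : ∃ g : ℝ, 0 < g ∧ ∀ x ∈ Set.Icc (a i) (b i), ∀ y ∈ Set.Icc (a j) (b j),
          g ≤ |x - y| := by
        have hd := Set.disjoint_left.1 (hdisj hij)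
        have hlt : b i < a j ∨ b j < a i := by
          by_contra! H
          exact hd (a := max (a i) (a j)) ⟨le_max_left _ _, max_le (hab i) H.1⟩
            ⟨le_max_right _ _, max_le H.2 (hab j)⟩
        rcases hlt with hlt | hlt
        · exact ⟨a j - b i, sub_pos.2 hlt, fun x hx y hy => by
            rw [abs_sub_comm]; exact le_trans (by linarith [hx.2, hy.1]) (le_abs_self _)⟩
        · exact ⟨a i - b j, sub_pos.2 hlt, fun x hx y hy =>
            le_trans (by linarith [hx.1, hy.2]) (le_abs_self _)⟩
      obtain ⟨g, hg, hgle⟩ := hgap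
      have hD : 0 ≤ (b i - a i) + (b j - a j) := by linarith [hab i, hab j]
      refine ⟨((b i - a i) + (b j - a j)) / g, by positivity, fun x hx y hy => ?_⟩
      rw [hφ i x hx, hφ j y hy, div_mul_eq_mul_div, le_div_iff₀ hg]
      have h1 : |x - (a i + b i) / 2 - (y - (a j + b j) / 2)|
          ≤ (b i - a i) + (b j - a j) := by
        rw [abs_le]
        constructor <;> linarith [hx.1, hx.2, hy.1, hy.2, hab i, hab j]
      exact mul_le_mul h1 (hgle x hx y hy) hg.le hD
  choose C hC0 hC using hpair
  refine ⟨φ, ∑ i, ∑ j, C i j, ?_, Finset.sum_nonneg fun i _ => Finset.sum_nonneg fun j _ => hC0 i j,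
    hφ, ?_⟩
  · exact Finset.measurable_sum _ fun j _ =>
      (measurable_id.sub_const _).indicator measurableSet_Icc
  · intro x hx y hy
    obtain ⟨i, hi⟩ := Set.mem_iUnion.1 hx
    obtain ⟨j, hj⟩ := Set.mem_iUnion.1 hy
    refine (hC i j x hi y hj).trans (mul_le_mul_of_nonneg_right ?_ (abs_nonneg _))
    exact (Finset.single_le_sum (fun j _ => hC0 i j) (Finset.mem_univ j)).trans
      (Finset.single_le_sum (f := fun i => ∑ j, C i j)
        (fun i _ => Finset.sum_nonneg fun j _ => hC0 i j) (Finset.mem_univ i))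

/-- A finite union of intervals can be shrunk, almost without decreasing distances, so that small
translates remain inside. -/
theorem exists_shrink {ℓ : ℕ} {a b : Fin ℓ → ℝ} (hab : ∀ j, a j ≤ b j)
    (hdisj : Pairwise (fun i j => Disjoint (Set.Icc (a i) (b i)) (Set.Icc (a j) (b j))))
    {c : ℝ} (hc : c < 1) :
    ∃ (T : ℝ → ℝ) (h : ℝ), Measurable T ∧ 0 < h ∧
      (∀ x ∈ ⋃ j, Set.Icc (a j) (b j), ∀ y ∈ ⋃ j, Set.Icc (a j) (b j),
        c * dist x y ≤ dist (T x) (T y)) ∧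
      ∀ x ∈ (⋃ j, Set.Icc (a j) (b j)) \ Set.range a, ∀ u ∈ Set.Icc (-h) h,
        T x + u ∈ ⋃ j, Set.Icc (a j) (b j) := by
  obtain ⟨φ, C, hφm, hC, hφ, hLip⟩ := exists_displacement_lipschitz hab hdisj
  obtain ⟨θ, ⟨hθ1, hθC⟩, hθ0⟩ : ∃ θ : ℝ, (θ < 1 ∧ θ * C < 1 - c) ∧ 0 < θ := by
    have h1 : ∀ᶠ θ : ℝ in 𝓝[>] 0, θ < 1 := eventually_nhdsWithin_of_eventually_nhds
      (eventually_lt_nhds one_pos)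
    have h2 : ∀ᶠ θ : ℝ in 𝓝[>] 0, θ * C < 1 - c := by
      have : Tendsto (fun θ : ℝ => θ * C) (𝓝 0) (𝓝 (0 * C)) := tendsto_id.mul_const C
      exact eventually_nhdsWithin_of_eventually_nhds
        (this.eventually_lt_const (by linarith))
    exact ((h1.and h2).and self_mem_nhdsWithin).exists
  obtain ⟨h, hh, hh0⟩ : ∃ h : ℝ, (∀ j, a j < b j → h ≤ θ * (b j - a j) / 2) ∧ 0 < h := by
    have h1 : ∀ᶠ h : ℝ in 𝓝[>] 0, ∀ j, a j < b j → h ≤ θ * (b j - a j) / 2 := by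
      refine eventually_all.2 fun j => ?_
      by_cases hj : a j < b j
      · have : 0 < θ * (b j - a j) / 2 := by
          have := sub_pos.2 hj
          positivity
        filter_upwards [eventually_nhdsWithin_of_eventually_nhds (eventually_le_nhds this)]
          with h hh _ using hh
      · simp [hj]
    exact (h1.and self_mem_nhdsWithin).exists
  -- Distances shrink by a factor at least `1 - θ * C > c`, and each interval gains a margin `θ * (b
  -- j - a j) / 2` at both ends. Degenerate intervals gain none; they are excluded with `Set.range
  -- a`.
  refine ⟨fun x => x - θ * φ x, h, measurable_id.sub (hφm.const_mul _), hh0, ?_, ?_⟩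
  · intro x hx y hy
    rw [Real.dist_eq, Real.dist_eq]
    have h1 : |x - y| ≤ |x - θ * φ x - (y - θ * φ y)| + |θ * (φ x - φ y)| := by
      refine le_trans (le_of_eq ?_) (abs_add_le _ _)
      congr 1; ring
    rw [abs_mul, abs_of_pos hθ0] at h1
    have h2 := mul_le_mul_of_nonneg_left (hLip x hx y hy) hθ0.le
    nlinarith [abs_nonneg (x - y)]
  · rintro x ⟨hx, hxa⟩ u hu
    obtain ⟨j, hj⟩ := Set.mem_iUnion.1 hx
    have hlt : a j < b j := by
      refine lt_of_le_of_ne (hab j) fun heq => hxa ⟨j, ?_⟩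
      exact le_antisymm hj.1 (heq ▸ hj.2)
    have h3 := hh j hlt
    refine Set.mem_iUnion.2 ⟨j, ?_⟩
    have h4 := hj.1
    have h5 := hj.2
    have h6 := hu.1
    have h7 := hu.2
    simp only [hφ j x hj]
    constructor <;> nlinarith

/-- Some translate of the image of `ρ` charges `B` at most proportionally to its volume. -/
theorem exists_translate_measure_le (ρ : Measure ℝ) [IsProbabilityMeasure ρ] {T : ℝ → ℝ}
    (hT : Measurable T) {B : Set ℝ} (hB : MeasurableSet B) {h δ : ℝ} (hδ : 0 < δ)
    (hvol : volume B < ENNReal.ofReal (2 * h * δ)) :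
    ∃ u ∈ Set.Icc (-h) h, ρ {x | T x + u ∈ B} ≤ ENNReal.ofReal δ := by
  by_contra! H
  have hmeas : MeasurableSet {p : ℝ × ℝ | T p.1 + p.2 ∈ B} :=
    ((hT.comp measurable_fst).add measurable_snd) hB
  have h1 : ENNReal.ofReal (2 * h * δ) ≤ ∫⁻ u in Set.Icc (-h) h, ρ {x | T x + u ∈ B} := by
    calc ENNReal.ofReal (2 * h * δ) = ∫⁻ _u in Set.Icc (-h) h, ENNReal.ofReal δ := by
          rw [setLIntegral_const, Real.volume_Icc, ← ENNReal.ofReal_mul hδ.le]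
          congr 1; ring
      _ ≤ _ := setLIntegral_mono' measurableSet_Icc fun u hu => (H u hu).le
  -- By Fubini and translation invariance the mass placed on `B`, integrated over all translations,
  -- is exactly its volume.
  have h2 : ∫⁻ u, ρ {x | T x + u ∈ B} = volume B := by
    calc ∫⁻ u, ρ {x | T x + u ∈ B} = ρ.prod volume {p : ℝ × ℝ | T p.1 + p.2 ∈ B} :=
          (Measure.prod_apply_symm hmeas).symm
      _ = ∫⁻ x, volume {u | T x + u ∈ B} ∂ρ := Measure.prod_apply hmeas
      _ = ∫⁻ _x, volume B ∂ρ := lintegral_congr fun x => measure_preimage_add volume (T x) B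
      _ = volume B := by simp
  exact absurd (h1.trans ((setLIntegral_le_lintegral _ _).trans h2.le)) (not_le.2 hvol)

/-- Contracting and conditioning each raise the energy by an arbitrarily small amount. The threshold
`s` does not depend on `S`, so it can be fixed before the degree of the polynomial defining `S`. -/
theorem HasLogEnergy.exists_pos_forall_subset {ℓ : ℕ} {a b : Fin ℓ → ℝ} (hab : ∀ j, a j ≤ b j)
    (hdisj : Pairwise (fun i j => Disjoint (Set.Icc (a i) (b i)) (Set.Icc (a j) (b j))))
    {E : Set ℝ} (hE : E = ⋃ j, Set.Icc (a j) (b j)) {ρ : Measure ℝ} [IsProbabilityMeasure ρ]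
    {I A : ℝ} (hρ : HasLogEnergy ρ I) (hρE : ρ Eᶜ = 0) (hIA : I < A) :
    ∃ s : ℝ, 0 < s ∧ ∀ S : Set ℝ, MeasurableSet S → volume (E \ S) < ENNReal.ofReal s →
      ∃ (σ : Measure ℝ) (J : ℝ), IsProbabilityMeasure σ ∧ HasLogEnergy σ J ∧ J < A ∧
        σ (S ∩ E)ᶜ = 0 := by
  have hEm : MeasurableSet E := hE ▸ MeasurableSet.iUnion fun j => measurableSet_Icc
  have hEb : Bornology.IsBounded E := hE ▸ Bornology.isBounded_iUnion.2 fun j =>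
    Metric.isBounded_Icc _ _
  obtain ⟨R, hR1, hR⟩ := exists_dist_le_of_isBounded hEb
  obtain ⟨A', hIA', hA'⟩ := exists_between hIA
  have hIR := neg_log_le_of_hasLogEnergy hR1 hR hρE hρ
  obtain ⟨δ, hδ0, hδ1, hδ⟩ := exists_pos_forall_cond_energy_lt hR1 (by linarith) hA'
  -- The contraction by `exp (I - A')` adds at most `A' - I`, leaving the gap from `A'` to `A` for
  -- the conditioning.
  obtain ⟨T, h, hT, hh, hTd, hTE⟩ := exists_shrink hab hdisj
    (c := Real.exp (I - A')) (Real.exp_lt_one_iff.mpr (by linarith))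
  rw [← hE] at hTd hTE
  have hρE' : ρ (E \ Set.range a)ᶜ = 0 := by
    rw [Set.sdiff_eq, Set.compl_inter, compl_compl, measure_union_null_iff]
    exact ⟨hρE, hρ.measure_countable (Set.finite_range a).countable⟩
  refine ⟨2 * h * δ, by positivity, fun S hS hSvol => ?_⟩
  obtain ⟨u, hu, hule⟩ := exists_translate_measure_le ρ hT (hEm.diff hS) hδ0 hSvol
  have hTu : Measurable fun x => T x + u := hT.add_const u
  have := Measure.isProbabilityMeasure_map (μ := ρ) hTu.aemeasurable
  obtain ⟨J, hJ, hJE⟩ := hρ.exists_map hρE' hTu (Real.exp_pos (I - A')) (K' := E)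
    (fun x hx y hy => by simpa using hTd x hx.1 y hy.1) (fun x hx => hTE x hx u hu) hEb
  have hmapE : ρ.map (fun x => T x + u) Eᶜ = 0 := by
    rw [Measure.map_apply hTu hEm.compl]
    exact measure_mono_null (fun x hx hx' => hx (hTE x hx' u hu)) hρE'
  have hmapS : (ρ.map (fun x => T x + u)).real Sᶜ ≤ δ := by
    refine ENNReal.toReal_le_of_le_ofReal hδ0.le (le_trans ?_ hule)
    calc ρ.map (fun x => T x + u) Sᶜ
        ≤ ρ.map (fun x => T x + u) (E \ S ∪ Eᶜ) := measure_mono fun x hx => by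
          by_cases hxE : x ∈ E
          · exact Or.inl ⟨hxE, hx⟩
          · exact Or.inr hxE
      _ ≤ ρ.map (fun x => T x + u) (E \ S) + ρ.map (fun x => T x + u) Eᶜ := measure_union_le _ _
      _ = ρ {x | T x + u ∈ E \ S} := by
          rw [hmapE, add_zero, Measure.map_apply hTu (hEm.diff hS)]
          rfl
  obtain ⟨J', hJ'A, hJ'⟩ := hδ _ J E S hJE (by rw [Real.log_exp] at hJ; linarith) hmapE hR hS hmapS
  have hS0 : ρ.map (fun x => T x + u) S ≠ 0 := by
    intro h0
    rw [probReal_compl_eq_one_sub hS, Measure.real, h0] at hmapS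
    simp at hmapS
    linarith
  refine ⟨_, J', ProbabilityTheory.cond_isProbabilityMeasure hS0, hJ', hJ'A, ?_⟩
  rw [Set.compl_inter, measure_union_null_iff]
  constructor
  · rw [ProbabilityTheory.cond_apply hS]; simp
  · exact ProbabilityTheory.cond_absolutelyContinuous hmapE

/-! ### Sublevel sets and the lower bound for the norms -/

/-- The `r`-neighbourhood of a polynomial sublevel set exceeds the set itself by at most `2r` for
every boundary point. -/
theorem volume_thickening_sublevel_diff_le {P : Polynomial ℝ} {n : ℕ} (hP : P.Monic)
    (hn : P.natDegree = n) (hn0 : 0 < n) {t r : ℝ} (hr : 0 ≤ r) :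
    volume ({x | ∃ y ∈ Set.Icc (x - r) (x + r), |P.eval y| ≤ t} \ {x | |P.eval x| ≤ t})
      ≤ ENNReal.ofReal (4 * n * r) := by
  -- Every point where `|P| = t` is one of its at most `2 n` roots. A point gained by thickening
  -- lies within `r` of such a root, by the intermediate value theorem.
  set Q := P ^ 2 - Polynomial.C (t ^ 2)
  have hQdeg : Q.natDegree = 2 * n := by
    rw [Polynomial.natDegree_sub_C, hP.natDegree_pow, hn]
  have hQ0 : Q ≠ 0 := fun h => by rw [h, Polynomial.natDegree_zero] at hQdeg; omega
  have hsub : {x | ∃ y ∈ Set.Icc (x - r) (x + r), |P.eval y| ≤ t} \ {x | |P.eval x| ≤ t}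
      ⊆ ⋃ z ∈ Q.roots.toFinset, Set.Icc (z - r) (z + r) := by
    rintro x ⟨⟨y, hy, hyt⟩, hx⟩
    simp only [Set.mem_ofPred_eq, not_le] at hx
    obtain ⟨z, hz, hzt⟩ := intermediate_value_uIcc (a := y) (b := x)
      (f := fun x => |P.eval x|) (by fun_prop) (Set.mem_uIcc.2 (Or.inl ⟨hyt, hx.le⟩))
    refine Set.mem_biUnion (x := z) ?_ ?_
    · simp only [Finset.mem_coe, Multiset.mem_toFinset]
      rw [Polynomial.mem_roots hQ0, Polynomial.IsRoot, Polynomial.eval_sub, Polynomial.eval_pow,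
        Polynomial.eval_C, ← hzt, sq_abs, sub_self]
    · have hz1 : |z - x| ≤ |y - x| := by
        rw [abs_sub_comm z, abs_sub_comm y]
        exact Set.abs_sub_right_of_mem_uIcc hz
      have hy1 : |y - x| ≤ r := abs_le.2 ⟨by linarith [hy.1], by linarith [hy.2]⟩
      have := abs_le.1 (hz1.trans hy1)
      constructor <;> linarith [this.1, this.2]
  calc _ ≤ volume (⋃ z ∈ Q.roots.toFinset, Set.Icc (z - r) (z + r)) := measure_mono hsub
    _ ≤ ∑ z ∈ Q.roots.toFinset, volume (Set.Icc (z - r) (z + r)) := measure_biUnion_finset_le _ _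
    _ = ENNReal.ofReal (Q.roots.toFinset.card * (2 * r)) := by
        simp only [Real.volume_Icc]
        rw [Finset.sum_congr rfl fun z _ => by rw [show z + r - (z - r) = 2 * r by ring],
          Finset.sum_const, nsmul_eq_mul, ENNReal.ofReal_mul (Nat.cast_nonneg _),
          ENNReal.ofReal_natCast]
    _ ≤ _ := by
        apply ENNReal.ofReal_le_ofReal
        have h1 : Q.roots.toFinset.card ≤ 2 * n :=
          (Multiset.toFinset_card_le _).trans ((Polynomial.card_roots' _).trans_eq hQdeg)
        have h2 : (Q.roots.toFinset.card : ℝ) ≤ 2 * n := by exact_mod_cast h1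
        nlinarith

theorem exists_abs_eval_le_of_lt_measure {μ : Measure ℝ} [IsFiniteMeasure μ]
    (hμ : IsCompact μ.support) (P : Polynomial ℝ) {B : Set ℝ} (hB : MeasurableSet B) {t ε : ℝ}
    (ht : 0 < t) (hε : ENNReal.ofReal ε < μ B) (hP : polyL2Norm μ P ^ 2 ≤ t ^ 2 * ε) :
    ∃ y ∈ B, |P.eval y| ≤ t := by
  by_contra! H
  have hint : Integrable (fun x => P.eval x ^ 2) μ := by
    simpa only [sq] using integrable_eval_mul_of_isCompact_support hμ P P
  have h1 : t ^ 2 * μ.real B ≤ ∫ x, P.eval x ^ 2 ∂μ := by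
    calc t ^ 2 * μ.real B = ∫ _x in B, t ^ 2 ∂μ := by simp [mul_comm]
      _ ≤ ∫ x in B, P.eval x ^ 2 ∂μ :=
          setIntegral_mono_on (integrable_const _) hint.integrableOn hB fun x hx =>
            sq_le_sq.2 (by rw [abs_of_pos ht]; exact (H x hx).le)
      _ ≤ _ := setIntegral_le_integral hint (ae_of_all _ fun x => sq_nonneg _)
  have h2 : ε < μ.real B := by
    rcases le_or_gt 0 ε with h | h
    · exact (ENNReal.ofReal_lt_iff_lt_toReal h (measure_ne_top _ _)).1 hε
    · exact h.trans_le measureReal_nonneg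
  rw [polyL2Norm, Real.sq_sqrt (integral_nonneg fun x => sq_nonneg _)] at hP
  nlinarith [mul_lt_mul_of_pos_left h2 (pow_pos ht 2)]

/-- Extremality plays no role here: the bound holds for any monic sequence of the right degrees. -/
theorem eventually_le_polyL2Norm {ℓ : ℕ} {a b : Fin ℓ → ℝ} (hab : ∀ j, a j ≤ b j)
    (hdisj : Pairwise (fun i j => Disjoint (Set.Icc (a i) (b i)) (Set.Icc (a j) (b j))))
    {E : Set ℝ} (hE : E = ⋃ j, Set.Icc (a j) (b j)) {μ : Measure ℝ} [IsFiniteMeasure μ]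
    (hcomp : IsCompact μ.support) (hess : essSupport μ = E)
    (hμ : ∀ η : ℝ, 0 < η →
      Tendsto (fun m : ℕ => volume {x : ℝ | x ∈ E ∧
          μ (Set.Icc (x - 1 / (m : ℝ)) (x + 1 / (m : ℝ)))
            ≤ ENNReal.ofReal (Real.exp (-((m : ℝ) * η)))})
        atTop (𝓝 0))
    {P : ℕ → Polynomial ℝ} (hP : ∀ n, (P n).Monic) (hPn : ∀ n, (P n).natDegree = n) {c : ℝ}
    (hc0 : 0 < c) (hc : c < logCapacity μ.support) :
    ∀ᶠ n in atTop, c ^ n ≤ polyL2Norm μ (P n) := by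
  obtain ⟨d, hcd, hd⟩ := exists_between hc
  have hd0 : 0 < d := hc0.trans hcd
  obtain ⟨ρ, I, hρ1, hρ, hI, hId⟩ := exists_hasLogEnergy_of_lt_logCapacity hcomp.isBounded hd0 hd
  have hρE : ρ Eᶜ = 0 := by
    refine measure_mono_null (t := μ.supportᶜ ∪ {x | x ∈ μ.support ∧ ¬AccPt x (𝓟 μ.support)}) ?_
      (measure_union_null hρ (hI.measure_countable (countable_setOf_not_accPt _)))
    intro x hx
    by_cases hxs : x ∈ μ.support
    · exact Or.inr ⟨hxs, fun h => hx (hess ▸ ⟨hxs, h⟩)⟩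
    · exact Or.inl hxs
  obtain ⟨s, hs0, hs⟩ := hI.exists_pos_forall_subset hab hdisj hE hρE hId
  have hEm : MeasurableSet E := hE ▸ MeasurableSet.iUnion fun j => measurableSet_Icc
  obtain ⟨R, hR⟩ := (hE ▸ isCompact_iUnion fun j => isCompact_Icc : IsCompact E)
    |>.exists_bound_of_continuousOn (f := fun x : ℝ => x) continuousOn_id
  -- With `m = k * n` the thickening costs `4 n / m = 4 / k < s / 2`; the other half of `s` is left
  -- for the exceptional set of the hypothesis.
  obtain ⟨k, hk⟩ := exists_nat_gt (8 / s)
  have hk0 : (0 : ℝ) < k := (by positivity : (0 : ℝ) < 8 / s).trans hk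
  have hkN : 0 < k := by exact_mod_cast hk0
  have hlog : 0 < Real.log (d / c) := Real.log_pos ((one_lt_div hc0).2 hcd)
  -- At scale `m = k * n` this rate gives `d ^ (2 n) * exp (-m η) = c ^ (2 n)`, which is what
  -- Chebyshev's inequality needs.
  have hη : 0 < 2 * Real.log (d / c) / k := by positivity
  have hbad := (hμ _ hη).comp (tendsto_id.const_mul_atTop' hkN)
  filter_upwards [hbad.eventually_lt_const (ENNReal.ofReal_pos.2 (half_pos hs0)),
    eventually_gt_atTop 0] with n hn hn0
  by_contra! hlt
  have hnR : (0 : ℝ) < n := by exact_mod_cast hn0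
  set m := k * n with hm
  simp only [Function.comp_apply, id, ← hm] at hn
  set S := {x | |(P n).eval x| ≤ d ^ n} with hS
  have hSm : MeasurableSet S :=
    (isClosed_le (P n).continuous.abs continuous_const).measurableSet
  have hmη : (m : ℝ) * (2 * Real.log (d / c) / k) = 2 * n * Real.log (d / c) := by
    rw [hm]; push_cast; field_simp
  have hexp : (d ^ n) ^ 2 * Real.exp (-((m : ℝ) * (2 * Real.log (d / c) / k))) = (c ^ n) ^ 2 := by
    rw [hmη, Real.exp_neg, mul_comm (2 * (n : ℝ)), Real.exp_mul, Real.exp_log (by positivity)]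
    rw [show (2 * (n : ℝ)) = ((n * 2 : ℕ) : ℝ) by push_cast; ring, Real.rpow_natCast, pow_mul,
      div_pow, div_pow]
    field_simp
  have hsub : E \ S ⊆ {x : ℝ | x ∈ E ∧ μ (Set.Icc (x - 1 / (m : ℝ)) (x + 1 / (m : ℝ)))
      ≤ ENNReal.ofReal (Real.exp (-((m : ℝ) * (2 * Real.log (d / c) / k))))} ∪
      ({x | ∃ y ∈ Set.Icc (x - 1 / (m : ℝ)) (x + 1 / (m : ℝ)), |(P n).eval y| ≤ d ^ n} \ S) := by
    rintro x ⟨hxE, hxS⟩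
    by_cases hx : μ (Set.Icc (x - 1 / (m : ℝ)) (x + 1 / (m : ℝ)))
      ≤ ENNReal.ofReal (Real.exp (-((m : ℝ) * (2 * Real.log (d / c) / k))))
    · exact Or.inl ⟨hxE, hx⟩
    · refine Or.inr ⟨exists_abs_eval_le_of_lt_measure hcomp (P n) measurableSet_Icc
        (pow_pos hd0 n) (not_le.1 hx) ?_, hxS⟩
      rw [hexp]
      exact pow_le_pow_left₀ (Real.sqrt_nonneg _) hlt.le 2
  have hvol : volume (E \ S) < ENNReal.ofReal s := by
    have hle := volume_thickening_sublevel_diff_le (hP n) (hPn n) hn0 (t := d ^ n)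
      (r := 1 / (m : ℝ)) (by positivity)
    have h4 : 4 * (n : ℝ) * (1 / (m : ℝ)) ≤ s / 2 := by
      rw [div_lt_iff₀ hs0] at hk
      rw [hm]; push_cast
      rw [mul_one_div, div_le_iff₀ (by positivity)]
      nlinarith
    calc volume (E \ S) ≤ _ := (measure_mono hsub).trans (measure_union_le _ _)
      _ < ENNReal.ofReal (s / 2) + ENNReal.ofReal (s / 2) :=
          ENNReal.add_lt_add_of_lt_of_le (ne_top_of_le_ne_top ENNReal.ofReal_ne_top
            (hle.trans (ENNReal.ofReal_le_ofReal h4))) hn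
            (hle.trans (ENNReal.ofReal_le_ofReal h4))
      _ = ENNReal.ofReal s := by
          rw [← ENNReal.ofReal_add (by positivity) (by positivity), add_halves]
  obtain ⟨σ, J, hσ1, hσ, hJ, hσS⟩ := hs S hSm hvol
  have hfin := hσ.neg_mul_le_log hσS (hP n) (hPn n) hn0 (pow_pos hd0 n)
    (fun x hx => hR x hx.2) (fun x hx => hx.1)
  rw [Real.log_pow] at hfin
  -- The bounds `-(n J) ≤ n log d` and `J < -log d` are incompatible.
  nlinarith

theorem theorem1p11 (ℓ : ℕ) (a b : Fin ℓ → ℝ) (hab : ∀ j, a j ≤ b j)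
    (hdisj : Pairwise (fun i j => Disjoint (Set.Icc (a i) (b i)) (Set.Icc (a j) (b j))))
    (E : Set ℝ) (hE : E = ⋃ j, Set.Icc (a j) (b j))
    (μ : Measure ℝ) [IsFiniteMeasure μ] (hcomp : IsCompact μ.support)
    (hess : essSupport μ = E)
    (hμ : ∀ η : ℝ, 0 < η →
      Tendsto (fun m : ℕ => volume {x : ℝ | x ∈ E ∧
          μ (Set.Icc (x - 1 / (m : ℝ)) (x + 1 / (m : ℝ)))
            ≤ ENNReal.ofReal (Real.exp (-((m : ℝ) * η)))})
        atTop (𝓝 0)) :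
    IsRegularMeasure μ := by
  have hP := isMonicOrthogonalSeq_monicOrthoPoly hcomp
  have hroot : ∀ n : ℕ, 0 < n → ∀ c : ℝ, 0 ≤ c → (c ^ n) ^ (1 / (n : ℝ)) = c := fun n hn c hc => by
    rw [one_div, Real.pow_rpow_inv_natCast hc hn.ne']
  refine ⟨hcomp, monicOrthoPoly μ, hP, tendsto_order.2 ⟨fun c hc => ?_, fun c hc => ?_⟩⟩
  · rcases lt_or_ge c 0 with hc0 | hc0
    · exact Eventually.of_forall fun n => hc0.trans_le (Real.rpow_nonneg (Real.sqrt_nonneg _) _)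
    obtain ⟨d, hcd, hd⟩ := exists_between hc
    have hd0 := hc0.trans_lt hcd
    filter_upwards [eventually_le_polyL2Norm hab hdisj hE hcomp hess hμ hP.monic hP.natDegree_eq
      hd0 hd, eventually_gt_atTop 0] with n hn hn0
    refine hcd.trans_le ?_
    rw [← hroot n hn0 d hd0.le]
    exact Real.rpow_le_rpow (by positivity) hn (by positivity)
  · obtain ⟨d, hd, hdc⟩ := exists_between hc
    have hd0 := (logCapacity_nonneg _).trans_lt hd
    filter_upwards [hP.eventually_polyL2Norm_le hcomp hd, eventually_gt_atTop 0] with n hn hn0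
    refine lt_of_le_of_lt ?_ hdc
    rw [← hroot n hn0 d hd0.le]
    exact Real.rpow_le_rpow (Real.sqrt_nonneg _) hn (by positivity)
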